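/- **Setting.** Let $(X,g)$ be an oriented Riemannian four-manifold with a $Spin(4)=Sp_+(1)\times Sp_-(1)$-structure $Q\to X$, let $Q_+=Q/Sp_-(1)$, and let $\varphi$ be the connection on $Q_+$ induced by the Levi-Civita connection. A point $f$ of $Q$ over $x$ gives an oriented isometry $T_xX\cong\mathbb H$ on which $(q_+,q_-)$ acts from the right by $\varkappa\mapsto \bar q_+\varkappa q_-$; left multiplication by $i,j,k$ gives complex structures $J_1,J_2,J_3$ on $T_xX$, depending only on the class of $f$ in $Q_+$. Let $\mathcal G$ be a (finite-dimensional) Lie group with Lie algebra $\mathcal L$ carrying an $Ad$-invariant scalar product, let $Sp(1)$ act smoothly on $\mathcal G$ by automorphisms, and let $M$ be a (finite-dimensional) hyperKähler manifold with complex structures $I_1,I_2,I_3$ and $\mathrm{Im}\,\mathbb H$-valued Kähler form $\omega=\omega_1i+\omega_2j+\omega_3k$. Let $\mathcal G\rtimes Sp(1)$ act smoothly and isometrically on $M$ so that $\mathcal G$ acts tri-Hamiltonianly with a $\mathcal G$- and $Sp(1)$-equivariant momentum map $\mu: M\to \mathrm{Im}\,\mathbb H\otimes\mathcal L$, and $Sp(1)$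 acts permutingly: $L_q^*\omega=q\,\omega\,\bar q$. For a manifold $N$ with an $Sp(1)$-action, sections of $Q_+\times_{Sp_+(1)}N$ are identified with smooth maps $\hat u:Q_+\to N$ satisfying $\hat u(fq)=\bar q\,\hat u(f)$. Put $\mathbb M=Q_+\times_{Sp_+(1)}M$, $\mathbb L=Q_+\times_{Sp_+(1)}\mathcal L$, $\mathbb G=Q_+\times_{Sp_+(1)}\mathcal G$. For $u\in\Gamma(\mathbb M)$ and $b\in\Omega^1(X;\mathbb L)$ let $\nabla^B u$ be the restriction of $\hat u_*+K_{b(\cdot)}(\hat u)$ to the $\varphi$-horizontal subspaces, identified with the tangent spaces of $X$, where $K_\xi$ is the Killing field of $\xi\in\mathcal L$. The Dirac operator $\mathcal D_b u$ is the $\mathbb H$-linear part $\frac14\bigl(A-\sum_j I_jAJ_j\bigr)$ of $A=\nabla^Bu$, and $\nu\circ u\in\Omega^2_+(X;\mathbb L)$ is the form corresponding to the equivariant map $\mu\circ\hat u$. The gauge group $\Gamma(\mathbb G)$ acts on pairs by $g\cdot(u,b)=(g\cdot u,\ Ad_g b-(\nabla^\varphi g)g^{-1})$. Let $\mathcal M^0_{TP}$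 be the set of solutions $(u,b)\in\Gamma(\mathbb M)\times\Omega^1(X;\mathbb L)$ of $$\mathcal D_b u=0,\qquad \nu\circ u=0,$$ modulo $\Gamma(\mathbb G)$. **Hypotheses.** Assume that $0$ is a regular value of $\mu$, that $\mathcal G$ acts freely on $\mu^{-1}(0)$, and that the hyperKähler reduction $M_0=\mu^{-1}(0)/\mathcal G$ is a smooth manifold with $\mu^{-1}(0)\to M_0$ a smooth principal $\mathcal G$-bundle (this is automatic if $\mathcal G$ is compact). The complex structures of $M_0$ are those induced by $I_1,I_2,I_3$ on the orthogonal complement of the $\mathcal G$-orbits in $T\mu^{-1}(0)$, and $Sp(1)$ acts on $M_0$ by the induced action. Let $\mathbb M_0=Q_+\times_{Sp_+(1)}M_0$. Let $\mathcal H_0(\mathbb M_0)$ be the set of sections $v\in\Gamma(\mathbb M_0)$ such that * $v$ is a pure harmonic spinor, i.e. the $\mathbb H$-linear part of the $\varphi$-horizontal derivative of $\hat v$ vanishes, and * the pulled-back $\mathcal G$-bundle $\hat v^*\mu^{-1}(0)\to Q_+$ is trivial, compatibly with the actions of $Sp_+(1)$; that is, it is isomorphic over $Q_+$ to $Q_+\times\mathcal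 G$, by an isomorphism equivariant under $\mathcal G$ and under $Sp_+(1)$, where $q$ acts on $Q_+\times\mathcal G$ by $(f,h)\mapsto(fq,\bar q\cdot h)$ and on the pullback by $(f,m)\mapsto(fq,\bar q\,m)$. **Theorem.** Under these hypotheses, sending $(u,b)$ to the composition of $\hat u:Q_+\to\mu^{-1}(0)$ with the projection $\mu^{-1}(0)\to M_0$ induces a well-defined bijection $\mathcal M^0_{TP}\to\mathcal H_0(\mathbb M_0)$. -/

import Mathlib

open scoped Manifold ContDiff Quaternion

noncomputable section

/-! ## The group `Sp(1)` of unit quaternions -/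

/-- `Sp(1)`, the group of unit quaternions. -/
abbrev Sp1 : Type := Metric.sphere (0 : ℍ[ℝ]) 1

instance Sp1.finrankFact : Fact (Module.finrank ℝ ℍ[ℝ] = 3 + 1) :=
  ⟨Quaternion.finrank_eq_four⟩

/-- `Sp(1)` with the smooth structure of the unit sphere in `ℍ` is a Lie group. -/
instance Sp1.lieGroup : LieGroup (𝓡 3) ∞ Sp1 where
  contMDiff_mul := by
    apply ContMDiff.codRestrict_sphere
    have h₂ : ContMDiff (𝓘(ℝ, ℍ[ℝ]).prod 𝓘(ℝ, ℍ[ℝ])) 𝓘(ℝ, ℍ[ℝ]) ∞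
        fun z : ℍ[ℝ] × ℍ[ℝ] => z.fst * z.snd := by
      rw [contMDiff_iff]
      exact ⟨continuous_mul, fun x y => contDiff_mul.contDiffOn⟩
    suffices h₁ : ContMDiff _ _ _ (Prod.map ((↑) : Sp1 → ℍ[ℝ]) ((↑) : Sp1 → ℍ[ℝ])) from
      h₂.comp h₁
    apply ContMDiff.prodMap <;> exact contMDiff_coe_sphere
  contMDiff_inv := by
    have hinv : ∀ q : Sp1, ((q⁻¹ : Sp1) : ℍ[ℝ]) = star (q : ℍ[ℝ]) := by
      intro q
      have hq : ‖(q : ℍ[ℝ])‖ = 1 := norm_eq_of_mem_sphere q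
      rw [Metric.unitSphere.coe_inv, Quaternion.inv_def, Quaternion.normSq_eq_norm_mul_self, hq]
      simp
    have h : ContMDiff (𝓡 3) 𝓘(ℝ, ℍ[ℝ]) ∞ (fun q : Sp1 => ((q⁻¹ : Sp1) : ℍ[ℝ])) := by
      simp only [hinv]
      let c : ℍ[ℝ] →ₗ[ℝ] ℍ[ℝ] :=
        { toFun := star, map_add' := star_add, map_smul' := fun r x => Quaternion.star_smul r x }
      exact ((LinearMap.toContinuousLinearMap c).contDiff.contMDiff).comp contMDiff_coe_sphere
    exact ContMDiff.codRestrict_sphere h (fun q => (q⁻¹ : Sp1).2)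

/-- `Spin(4) = Sp₊(1) × Sp₋(1)`. -/
abbrev Spin4 : Type := Sp1 × Sp1

/-- The right action of `Spin(4)` on a space carrying an action of the opposite group. -/
abbrev rightAct {Q : Type*} [MulAction Spin4ᵐᵒᵖ Q] (a : Spin4) (f : Q) : Q := MulOpposite.op a • f

/-- The imaginary units `i, j, k`. -/
def imUnit : Fin 3 → ℍ[ℝ] := ![⟨0, 1, 0, 0⟩, ⟨0, 0, 1, 0⟩, ⟨0, 0, 0, 1⟩]

/-- The imaginary quaternion with coordinates `c`. -/
def imQuat (c : Fin 3 → ℝ) : ℍ[ℝ] := ⟨0, c 0, c 1, c 2⟩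

/-- The standard orientation of `ℍ`, given by the basis `1, i, j, k`. -/
def quaternionOrientation : Orientation ℝ ℍ[ℝ] (Fin 4) :=
  (QuaternionAlgebra.basisOneIJK (-1 : ℝ) 0 (-1)).orientation

/-! ## Smooth principal bundles -/

/-- `π : P → B` is a smooth principal bundle with structure group `H` acting on `P` through `act`
(a left or a right action): near each point of `B` there are a smooth section `s` and a smooth map
`τ` to `H` such that `(x, h) ↦ act h (s x)` and `p ↦ (π p, τ p)` are mutually inverse. -/
structure IsPrincipalBundle {EB HB EP HP EH HH B P H : Type*}
    [NormedAddCommGroup EB] [NormedSpace ℝ EB] [TopologicalSpace HB] (IB : ModelWithCorners ℝ EB HB)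
    [NormedAddCommGroup EP] [NormedSpace ℝ EP] [TopologicalSpace HP] (IP : ModelWithCorners ℝ EP HP)
    [NormedAddCommGroup EH] [NormedSpace ℝ EH] [TopologicalSpace HH] (IH : ModelWithCorners ℝ EH HH)
    [TopologicalSpace B] [ChartedSpace HB B] [TopologicalSpace P] [ChartedSpace HP P]
    [TopologicalSpace H] [ChartedSpace HH H] (act : H → P → P) (π : P → B) : Prop where
  smooth_act : ContMDiff (IH.prod IP) IP ∞ (fun z : H × P => act z.1 z.2)
  smooth_proj : ContMDiff IP IB ∞ π
  proj_act : ∀ h p, π (act h p) = π p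
  locally_trivial : ∀ x₀ : B, ∃ U : Set B, IsOpen U ∧ x₀ ∈ U ∧ ∃ (s : B → P) (τ : P → H),
    ContMDiffOn IB IP ∞ s U ∧ ContMDiffOn IP IH ∞ τ (π ⁻¹' U) ∧
    (∀ x ∈ U, π (s x) = x ∧ ∀ h, τ (act h (s x)) = h) ∧
    (∀ p ∈ π ⁻¹' U, act (τ p) (s (π p)) = p)

/-! ## The source manifold -/

/-- A smooth Riemannian metric on a manifold modelled on `E`. -/
abbrev SmoothMetric (E : Type*) [NormedAddCommGroup E] [NormedSpace ℝ E]
    (X : Type*) [TopologicalSpace X] [ChartedSpace E X] [IsManifold 𝓘(ℝ, E) ∞ X] : Type _ :=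
  Bundle.ContMDiffRiemannianMetric 𝓘(ℝ, E) ∞ E (fun x : X => TangentSpace 𝓘(ℝ, E) x)

/-- A `Spin(4)`-structure on an oriented Riemannian four-manifold `(X, g, o)`: a principal
`Spin(4)`-bundle `π : Q → X` together with an equivariant map to the bundle of oriented isometries
`TₓX → ℍ`, on which `(q₊, q₋)` acts from the right by `ϰ ↦ q̄₊ ϰ q₋`. The orientation `o` is
automatically continuous, since the frames are. -/
structure SpinStructure {X : Type*} [TopologicalSpace X] [ChartedSpace (EuclideanSpace ℝ (Fin 4)) X]
    [IsManifold (𝓡 4) ∞ X] (g : SmoothMetric (EuclideanSpace ℝ (Fin 4)) X)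
    (o : ∀ x : X, Orientation ℝ (TangentSpace (𝓡 4) x) (Fin 4))
    (EQ : Type*) [NormedAddCommGroup EQ] [NormedSpace ℝ EQ]
    (Q : Type*) [TopologicalSpace Q] [ChartedSpace EQ Q] [IsManifold 𝓘(ℝ, EQ) ∞ Q]
    [MulAction Spin4ᵐᵒᵖ Q] where
  proj : Q → X
  principal : IsPrincipalBundle (𝓡 4) 𝓘(ℝ, EQ) ((𝓡 3).prod (𝓡 3)) (rightAct (Q := Q)) proj
  frame : ∀ f : Q, TangentSpace (𝓡 4) (proj f) ≃L[ℝ] ℍ[ℝ]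
  frame_isometry : ∀ f v w, inner ℝ (frame f v) (frame f w) = g.inner (proj f) v w
  frame_oriented : ∀ f,
    Orientation.map (Fin 4) (frame f).toLinearEquiv (o (proj f)) = quaternionOrientation
  frame_smooth : ContMDiff 𝓘(ℝ, EQ).tangent 𝓘(ℝ, ℍ[ℝ]) ∞
    (fun w : TangentBundle 𝓘(ℝ, EQ) Q => frame w.1 (mfderiv 𝓘(ℝ, EQ) (𝓡 4) proj w.1 w.2))
  frame_equivariant : ∀ (a : Spin4) (f : Q) (w : TangentSpace 𝓘(ℝ, EQ) f),
    frame (rightAct a f) (mfderiv 𝓘(ℝ, EQ) (𝓡 4) proj (rightAct a f)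
      (mfderiv 𝓘(ℝ, EQ) 𝓘(ℝ, EQ) (rightAct a) f w))
    = star (a.1 : ℍ[ℝ]) * frame f (mfderiv 𝓘(ℝ, EQ) (𝓡 4) proj f w) * (a.2 : ℍ[ℝ])

section Source

variable {X : Type*} [TopologicalSpace X] [ChartedSpace (EuclideanSpace ℝ (Fin 4)) X]
  [IsManifold (𝓡 4) ∞ X] {g : SmoothMetric (EuclideanSpace ℝ (Fin 4)) X}
  {o : ∀ x : X, Orientation ℝ (TangentSpace (𝓡 4) x) (Fin 4)}
  {EQ : Type*} [NormedAddCommGroup EQ] [NormedSpace ℝ EQ]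
  {Q : Type*} [TopologicalSpace Q] [ChartedSpace EQ Q] [IsManifold 𝓘(ℝ, EQ) ∞ Q]
  [MulAction Spin4ᵐᵒᵖ Q]

/-- The complex structure `J₁, J₂` or `J₃` on the tangent space of `X` at the foot of `f`:
multiplication by `i, j` or `k` from the left in the frame `f`. -/
def SpinStructure.J (S : SpinStructure g o EQ Q) (j : Fin 3) (f : Q) :
    TangentSpace (𝓡 4) (S.proj f) →L[ℝ] TangentSpace (𝓡 4) (S.proj f) :=
  (S.frame f).symm.toContinuousLinearMap ∘L (ContinuousLinearMap.mul ℝ ℍ[ℝ] (imUnit j)) ∘L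
    (S.frame f).toContinuousLinearMap

/-- The Levi-Civita connection on the `Spin(4)`-bundle `Q`, given by its horizontal lift: the
torsion-free principal connection. The standard horizontal vector field of `h : ℍ` is the horizontal
field whose value in each frame is `h`, and vanishing torsion means that the bracket of two of them
is vertical. -/
structure LeviCivita (S : SpinStructure g o EQ Q) where
  lift : ∀ f : Q, TangentSpace (𝓡 4) (S.proj f) →L[ℝ] TangentSpace 𝓘(ℝ, EQ) f
  proj_lift : ∀ f v, mfderiv 𝓘(ℝ, EQ) (𝓡 4) S.proj f (lift f v) = v
  lift_smooth : ∀ h : ℍ[ℝ], ContMDiff 𝓘(ℝ, EQ) 𝓘(ℝ, EQ).tangent ∞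
    (fun f => (⟨f, lift f ((S.frame f).symm h)⟩ : TangentBundle 𝓘(ℝ, EQ) Q))
  lift_equivariant : ∀ (a : Spin4) (f : Q) (w : TangentSpace 𝓘(ℝ, EQ) f),
    mfderiv 𝓘(ℝ, EQ) 𝓘(ℝ, EQ) (rightAct a) f (lift f (mfderiv 𝓘(ℝ, EQ) (𝓡 4) S.proj f w))
    = lift (rightAct a f) (mfderiv 𝓘(ℝ, EQ) (𝓡 4) S.proj (rightAct a f)
        (mfderiv 𝓘(ℝ, EQ) 𝓘(ℝ, EQ) (rightAct a) f w))
  torsion_free : ∀ (h k : ℍ[ℝ]) (f : Q),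
    mfderiv 𝓘(ℝ, EQ) (𝓡 4) S.proj f
      (VectorField.mlieBracket 𝓘(ℝ, EQ) (fun f' => lift f' ((S.frame f').symm h))
        (fun f' => lift f' ((S.frame f').symm k)) f) = 0

end Source

/-! ## The target manifold -/

section Target

variable (E : Type*) [NormedAddCommGroup E] [NormedSpace ℝ E]
  (M : Type*) [TopologicalSpace M] [ChartedSpace E M]

/-- Smooth vector fields. -/
def IsSmoothField {E : Type*} [NormedAddCommGroup E] [NormedSpace ℝ E]
    {M : Type*} [TopologicalSpace M] [ChartedSpace E M] [IsManifold 𝓘(ℝ, E) ∞ M]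
    (V : ∀ m : M, TangentSpace 𝓘(ℝ, E) m) : Prop :=
  ContMDiff 𝓘(ℝ, E) 𝓘(ℝ, E).tangent ∞ (fun m => (⟨m, V m⟩ : TangentBundle 𝓘(ℝ, E) M))

/-- A hyperKähler structure: a Riemannian metric which is Kähler with respect to three complex
structures satisfying the quaternionic relations. -/
structure HyperKahler [IsManifold 𝓘(ℝ, E) ∞ M] where
  metric : SmoothMetric E M
  I : Fin 3 → ∀ m : M, TangentSpace 𝓘(ℝ, E) m →L[ℝ] TangentSpace 𝓘(ℝ, E) m
  I_smooth : ∀ i, ContMDiff 𝓘(ℝ, E).tangent 𝓘(ℝ, E).tangent ∞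
    (fun w : TangentBundle 𝓘(ℝ, E) M => (⟨w.1, I i w.1 w.2⟩ : TangentBundle 𝓘(ℝ, E) M))
  I_sq : ∀ i m v, I i m (I i m v) = -v
  I_mul : ∀ m v, I 0 m (I 1 m v) = I 2 m v
  I_orthogonal : ∀ i m v w, metric.inner m (I i m v) (I i m w) = metric.inner m v w
  /-- The Nijenhuis tensors vanish. -/
  I_integrable : ∀ i (U V : ∀ m : M, TangentSpace 𝓘(ℝ, E) m), IsSmoothField U → IsSmoothField V →
    ∀ m, VectorField.mlieBracket 𝓘(ℝ, E) (fun m => I i m (U m)) (fun m => I i m (V m)) m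
      - I i m (VectorField.mlieBracket 𝓘(ℝ, E) (fun m => I i m (U m)) V m)
      - I i m (VectorField.mlieBracket 𝓘(ℝ, E) U (fun m => I i m (V m)) m)
      - VectorField.mlieBracket 𝓘(ℝ, E) U V m = 0
  /-- The Kähler forms `ωᵢ = g(Iᵢ ·, ·)` are closed. -/
  kahler_closed : ∀ i (U V W : ∀ m : M, TangentSpace 𝓘(ℝ, E) m),
    IsSmoothField U → IsSmoothField V → IsSmoothField W → ∀ m,
      mvfderiv 𝓘(ℝ, E) (fun m => metric.inner m (I i m (V m)) (W m)) m (U m)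
      + mvfderiv 𝓘(ℝ, E) (fun m => metric.inner m (I i m (W m)) (U m)) m (V m)
      + mvfderiv 𝓘(ℝ, E) (fun m => metric.inner m (I i m (U m)) (V m)) m (W m)
      - metric.inner m (I i m (VectorField.mlieBracket 𝓘(ℝ, E) U V m)) (W m)
      - metric.inner m (I i m (VectorField.mlieBracket 𝓘(ℝ, E) V W m)) (U m)
      - metric.inner m (I i m (VectorField.mlieBracket 𝓘(ℝ, E) W U m)) (V m) = 0

/-- The Kähler forms `ωᵢ = g(Iᵢ ·, ·)`. -/
def HyperKahler.form {E M} [NormedAddCommGroup E] [NormedSpace ℝ E] [TopologicalSpace M]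
    [ChartedSpace E M] [IsManifold 𝓘(ℝ, E) ∞ M] (K : HyperKahler E M) (i : Fin 3) (m : M)
    (v w : TangentSpace 𝓘(ℝ, E) m) : ℝ :=
  K.metric.inner m (K.I i m v) w

variable (L : Type*) [NormedAddCommGroup L] [NormedSpace ℝ L]
  (G : Type*) [Group G] [TopologicalSpace G] [ChartedSpace L G]

/-- The Killing field `K_ξ(m) = d/dt exp(tξ) m` of an element `ξ` of the Lie algebra `T₁G = L`. -/
def killing {E M L G} [NormedAddCommGroup E] [NormedSpace ℝ E] [TopologicalSpace M]
    [ChartedSpace E M] [NormedAddCommGroup L] [NormedSpace ℝ L] [Group G] [TopologicalSpace G]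
    [ChartedSpace L G] [MulAction G M] (m : M) : L →L[ℝ] TangentSpace 𝓘(ℝ, E) m :=
  mfderiv 𝓘(ℝ, L) 𝓘(ℝ, E) (fun g : G => g • m) 1

/-- The adjoint action of `G` on its Lie algebra `L`. -/
def adjoint {L G} [NormedAddCommGroup L] [NormedSpace ℝ L] [Group G] [TopologicalSpace G]
    [ChartedSpace L G] (g : G) : L →L[ℝ] L :=
  mfderiv 𝓘(ℝ, L) 𝓘(ℝ, L) (fun h : G => g * h * g⁻¹) 1

/-- The action of `Sp(1)` on the Lie algebra `L` induced by an action by automorphisms of `G`. -/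
def lieAct {L G} [NormedAddCommGroup L] [NormedSpace ℝ L] [Group G] [TopologicalSpace G]
    [ChartedSpace L G] [MulDistribMulAction Sp1 G] (q : Sp1) : L →L[ℝ] L :=
  mfderiv 𝓘(ℝ, L) 𝓘(ℝ, L) (fun h : G => q • h) 1

/-- The target data: a hyperKähler manifold `M` with a smooth isometric action of `G ⋊ Sp(1)` such
that `G` acts tri-Hamiltonianly with momentum map `μ = (μ₁, μ₂, μ₃)`, `Sp(1)` acts permutingly and
`μ` is `Sp(1)`-equivariant. The homomorphism `Sp(1) → Aut(G)` is the action of `Sp(1)` on `G` by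
group automorphisms, and an action of `G ⋊ Sp(1)` is a pair of actions of `G` and of `Sp(1)`
satisfying `semidirect`. -/
structure TargetData [IsManifold 𝓘(ℝ, E) ∞ M] [MulDistribMulAction Sp1 G]
    [MulAction G M] [MulAction Sp1 M] extends HyperKahler E M where
  smooth_aut : ContMDiff ((𝓡 3).prod 𝓘(ℝ, L)) 𝓘(ℝ, L) ∞ (fun z : Sp1 × G => z.1 • z.2)
  /-- The `Ad`-invariant scalar product on the Lie algebra. -/
  ip : L →ₗ[ℝ] L →ₗ[ℝ] ℝ
  ip_symm : ∀ ξ η, ip ξ η = ip η ξ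
  ip_pos : ∀ ξ, ξ ≠ 0 → 0 < ip ξ ξ
  ip_adjoint : ∀ (g : G) ξ η, ip (adjoint g ξ) (adjoint g η) = ip ξ η
  smooth_G : ContMDiff (𝓘(ℝ, L).prod 𝓘(ℝ, E)) 𝓘(ℝ, E) ∞ (fun z : G × M => z.1 • z.2)
  smooth_Sp1 : ContMDiff ((𝓡 3).prod 𝓘(ℝ, E)) 𝓘(ℝ, E) ∞ (fun z : Sp1 × M => z.1 • z.2)
  semidirect : ∀ (q : Sp1) (g : G) (m : M), q • (g • m) = (q • g) • (q • m)
  isometric_G : ∀ (g : G) (m : M) v w, metric.inner (g • m)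
    (mfderiv 𝓘(ℝ, E) 𝓘(ℝ, E) (fun m : M => g • m) m v)
    (mfderiv 𝓘(ℝ, E) 𝓘(ℝ, E) (fun m : M => g • m) m w) = metric.inner m v w
  isometric_Sp1 : ∀ (q : Sp1) (m : M) v w, metric.inner (q • m)
    (mfderiv 𝓘(ℝ, E) 𝓘(ℝ, E) (fun m : M => q • m) m v)
    (mfderiv 𝓘(ℝ, E) 𝓘(ℝ, E) (fun m : M => q • m) m w) = metric.inner m v w
  /-- `G` preserves the complex structures. -/
  holomorphic_G : ∀ (g : G) i (m : M) v,
    mfderiv 𝓘(ℝ, E) 𝓘(ℝ, E) (fun m : M => g • m) m (I i m v)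
      = I i (g • m) (mfderiv 𝓘(ℝ, E) 𝓘(ℝ, E) (fun m : M => g • m) m v)
  /-- `L_q^* ω = q ω q̄` for `ω = ω₁ i + ω₂ j + ω₃ k`. -/
  permuting : ∀ (q : Sp1) (m : M) v w,
    imQuat (fun i => toHyperKahler.form i (q • m)
      (mfderiv 𝓘(ℝ, E) 𝓘(ℝ, E) (fun m : M => q • m) m v)
      (mfderiv 𝓘(ℝ, E) 𝓘(ℝ, E) (fun m : M => q • m) m w))
    = (q : ℍ[ℝ]) * imQuat (fun i => toHyperKahler.form i m v w) * star (q : ℍ[ℝ])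
  μ : Fin 3 → M → L
  μ_smooth : ∀ i, ContMDiff 𝓘(ℝ, E) 𝓘(ℝ, L) ∞ (μ i)
  /-- `d⟨μᵢ, ξ⟩ = ωᵢ(K_ξ, ·)`. -/
  μ_moment : ∀ i m (ξ : L) v,
    ip (mvfderiv 𝓘(ℝ, E) (μ i) m v) ξ = toHyperKahler.form i m (killing (G := G) m ξ) v
  μ_equivariant_G : ∀ (g : G) i m, μ i (g • m) = adjoint g (μ i m)
  /-- Equivariance of `μ : M → Im ℍ ⊗ L` under `Sp(1)`, tested on the second factor. -/
  μ_equivariant_Sp1 : ∀ (q : Sp1) m (ξ : L),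
    imQuat (fun i => ip (μ i (q • m)) ξ)
    = (q : ℍ[ℝ]) * imQuat (fun i => ip (lieAct (G := G) q (μ i m)) ξ) * star (q : ℍ[ℝ])

end Target

namespace TargetData

variable {E : Type*} [NormedAddCommGroup E] [NormedSpace ℝ E]
  {M : Type*} [TopologicalSpace M] [ChartedSpace E M] [IsManifold 𝓘(ℝ, E) ∞ M]
  {L : Type*} [NormedAddCommGroup L] [NormedSpace ℝ L]
  {G : Type*} [Group G] [TopologicalSpace G] [ChartedSpace L G]
  [MulDistribMulAction Sp1 G] [MulAction G M] [MulAction Sp1 M]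
  (T : TargetData E M L G)

/-- The zero level set `μ⁻¹(0)`, with the subspace topology. -/
abbrev Level : Type _ := {m : M // ∀ i, T.μ i m = 0}

/-- `0` is a regular value of `μ = (μ₁, μ₂, μ₃) : M → Im ℍ ⊗ L`. -/
def ZeroIsRegular : Prop :=
  ∀ m : M, (∀ i, T.μ i m = 0) →
    Function.Surjective fun (v : TangentSpace 𝓘(ℝ, E) m) (i : Fin 3) =>
      mvfderiv 𝓘(ℝ, E) (T.μ i) m v

/-- `G` acts freely on `μ⁻¹(0)`. -/
def FreeOnLevel : Prop :=
  ∀ (m : M) (g : G), (∀ i, T.μ i m = 0) → g • m = m → g = 1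

lemma level_smul (g : G) (m : M) (h : ∀ i, T.μ i m = 0) (i : Fin 3) : T.μ i (g • m) = 0 := by
  rw [T.μ_equivariant_G, h, map_zero]

lemma level_smul_Sp1 (q : Sp1) (m : M) (h : ∀ i, T.μ i m = 0) (i : Fin 3) :
    T.μ i (q • m) = 0 := by
  by_contra hne
  have hpos := T.ip_pos _ hne
  have key := T.μ_equivariant_Sp1 q m (T.μ i (q • m))
  have h0 : imQuat (fun j => T.ip (lieAct (G := G) q (T.μ j m)) (T.μ i (q • m))) = 0 := by
    simp only [h, map_zero, LinearMap.zero_apply]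
    rfl
  rw [h0, mul_zero, zero_mul] at key
  have : T.ip (T.μ i (q • m)) (T.μ i (q • m)) = 0 := by
    have h1 := congrArg QuaternionAlgebra.imI key
    have h2 := congrArg QuaternionAlgebra.imJ key
    have h3 := congrArg QuaternionAlgebra.imK key
    fin_cases i
    · exact h1
    · exact h2
    · exact h3
  exact hpos.ne' this

instance : MulAction G T.Level where
  smul g z := ⟨g • z.1, T.level_smul g z.1 z.2⟩
  one_smul z := Subtype.ext (one_smul G z.1)
  mul_smul g h z := Subtype.ext (mul_smul g h z.1)

instance : MulAction Sp1 T.Level where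
  smul q z := ⟨q • z.1, T.level_smul_Sp1 q z.1 z.2⟩
  one_smul z := Subtype.ext (one_smul Sp1 z.1)
  mul_smul g h z := Subtype.ext (mul_smul g h z.1)

/-- The hyperKähler reduction `M₀ = μ⁻¹(0)/G`, with the quotient topology. -/
def Reduction : Type _ := MulAction.orbitRel.Quotient G T.Level

instance : TopologicalSpace T.Reduction :=
  inferInstanceAs (TopologicalSpace (Quotient (MulAction.orbitRel G T.Level)))

/-- The projection `μ⁻¹(0) → M₀`. -/
def toReduction (z : T.Level) : T.Reduction := Quotient.mk (MulAction.orbitRel G T.Level) z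

/-- The action of `Sp(1)` on `M₀` induced by the permuting action on `M`. -/
instance : MulAction Sp1 T.Reduction where
  smul q := Quotient.map (fun z : T.Level => q • z) (by
    rintro _ z ⟨g, rfl⟩
    exact ⟨q • g, Subtype.ext (T.semidirect q g z.1).symm⟩)
  one_smul y := by
    induction y using Quotient.inductionOn with
    | h z => exact congrArg T.toReduction (one_smul Sp1 z)
  mul_smul p q y := by
    induction y using Quotient.inductionOn with
    | h z => exact congrArg T.toReduction (mul_smul p q z)

section Structures

variable {EZ : Type*} [NormedAddCommGroup EZ] [NormedSpace ℝ EZ] [ChartedSpace EZ T.Level]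
  {E₀ : Type*} [NormedAddCommGroup E₀] [NormedSpace ℝ E₀] [ChartedSpace E₀ T.Reduction]

/-- The differential of the inclusion `μ⁻¹(0) → M`. -/
def incl (EZ : Type*) [NormedAddCommGroup EZ] [NormedSpace ℝ EZ] [ChartedSpace EZ T.Level]
    (z : T.Level) : TangentSpace 𝓘(ℝ, EZ) z →L[ℝ] TangentSpace 𝓘(ℝ, E) z.1 :=
  mfderiv 𝓘(ℝ, EZ) 𝓘(ℝ, E) (Subtype.val : T.Level → M) z

/-- A tangent vector of `μ⁻¹(0)` is horizontal if it is orthogonal to the Killing vectors. -/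
def IsHorizontal {z : T.Level} (h : TangentSpace 𝓘(ℝ, EZ) z) : Prop :=
  ∀ ξ : L, T.metric.inner z.1 (T.incl EZ z h) (killing (G := G) z.1 ξ) = 0

/-- `A` is the `j`-th complex structure induced on `M₀`: under the identification of the tangent
space at the image of `z` with the horizontal tangent vectors at `z`, it is the restriction of
`I_j`. -/
def IsInducedI (EZ : Type*) [NormedAddCommGroup EZ] [NormedSpace ℝ EZ] [ChartedSpace EZ T.Level]
    (j : Fin 3) (A : ∀ y : T.Reduction, TangentSpace 𝓘(ℝ, E₀) y →L[ℝ] TangentSpace 𝓘(ℝ, E₀) y) :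
    Prop :=
  ∀ (z : T.Level) (h h' : TangentSpace 𝓘(ℝ, EZ) z),
    T.IsHorizontal h → T.incl EZ z h' = T.I j z.1 (T.incl EZ z h) →
    A (T.toReduction z) (mfderiv 𝓘(ℝ, EZ) 𝓘(ℝ, E₀) T.toReduction z h)
      = mfderiv 𝓘(ℝ, EZ) 𝓘(ℝ, E₀) T.toReduction z h'

open Classical in
/-- The complex structures of the hyperKähler reduction (the family described by `IsInducedI` is
unique, the projection being a submersion that is injective on horizontal vectors). -/
def reducedI (EZ : Type*) [NormedAddCommGroup EZ] [NormedSpace ℝ EZ] [ChartedSpace EZ T.Level]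
    (E₀ : Type*) [NormedAddCommGroup E₀] [NormedSpace ℝ E₀] [ChartedSpace E₀ T.Reduction]
    (j : Fin 3) :
    ∀ y : T.Reduction, TangentSpace 𝓘(ℝ, E₀) y →L[ℝ] TangentSpace 𝓘(ℝ, E₀) y :=
  if h : ∃ A, T.IsInducedI (E₀ := E₀) EZ j A then h.choose else fun _ => 0

end Structures

end TargetData

/-! ## Spinors, Dirac operators and moduli spaces -/

section Spinors

variable {X : Type*} [TopologicalSpace X] [ChartedSpace (EuclideanSpace ℝ (Fin 4)) X]
  [IsManifold (𝓡 4) ∞ X] {g : SmoothMetric (EuclideanSpace ℝ (Fin 4)) X}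
  {o : ∀ x : X, Orientation ℝ (TangentSpace (𝓡 4) x) (Fin 4)}
  {EQ : Type*} [NormedAddCommGroup EQ] [NormedSpace ℝ EQ]
  {Q : Type*} [TopologicalSpace Q] [ChartedSpace EQ Q] [IsManifold 𝓘(ℝ, EQ) ∞ Q]
  [MulAction Spin4ᵐᵒᵖ Q]

/-- Spinors with values in an `Sp(1)`-manifold `N`: smooth sections of `Q₊ ×_{Sp₊(1)} N`, as
equivariant maps. Since `Q₊ = Q / Sp₋(1)`, maps on `Q₊` are `Sp₋(1)`-invariant maps on `Q`. -/
structure Spinor (EQ : Type*) [NormedAddCommGroup EQ] [NormedSpace ℝ EQ]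
    (Q : Type*) [TopologicalSpace Q] [ChartedSpace EQ Q] [IsManifold 𝓘(ℝ, EQ) ∞ Q]
    [MulAction Spin4ᵐᵒᵖ Q]
    (EN : Type*) [NormedAddCommGroup EN] [NormedSpace ℝ EN]
    (N : Type*) [TopologicalSpace N] [ChartedSpace EN N] [MulAction Sp1 N] where
  toFun : Q → N
  smooth : ContMDiff 𝓘(ℝ, EQ) 𝓘(ℝ, EN) ∞ toFun
  equivariant : ∀ (a : Spin4) (f : Q), toFun (rightAct a f) = a.1⁻¹ • toFun f

/-- The Dirac operator in equivariant form: the projection `A ↦ (A - Σⱼ Iⱼ A Jⱼ) / 4` of a covariant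
derivative `A : T_x X → T_n N`, where `x` is the foot of `f`, to its `ℍ`-linear part. -/
def linearPart (S : SpinStructure g o EQ Q)
    {EN : Type*} [NormedAddCommGroup EN] [NormedSpace ℝ EN]
    {N : Type*} [TopologicalSpace N] [ChartedSpace EN N] {n : N}
    (I : Fin 3 → TangentSpace 𝓘(ℝ, EN) n →L[ℝ] TangentSpace 𝓘(ℝ, EN) n) (f : Q)
    (A : TangentSpace (𝓡 4) (S.proj f) →L[ℝ] TangentSpace 𝓘(ℝ, EN) n) :
    TangentSpace (𝓡 4) (S.proj f) →L[ℝ] TangentSpace 𝓘(ℝ, EN) n :=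
  (1 / 4 : ℝ) • (A - ∑ j, I j ∘L A ∘L S.J j f)

/-- The covariant derivative of a map `Q → N` with respect to the Levi-Civita connection, i.e. the
restriction of its differential to the horizontal subspaces. -/
def horizontalDeriv {S : SpinStructure g o EQ Q} (C : LeviCivita S)
    {EN : Type*} [NormedAddCommGroup EN] [NormedSpace ℝ EN]
    {N : Type*} [TopologicalSpace N] [ChartedSpace EN N] (u : Q → N) (f : Q) :
    TangentSpace (𝓡 4) (S.proj f) →L[ℝ] TangentSpace 𝓘(ℝ, EN) (u f) :=
  (mfderiv 𝓘(ℝ, EQ) 𝓘(ℝ, EN) u f) ∘L (C.lift f)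

variable {E : Type*} [NormedAddCommGroup E] [NormedSpace ℝ E]
  {M : Type*} [TopologicalSpace M] [ChartedSpace E M] [IsManifold 𝓘(ℝ, E) ∞ M]
  {L : Type*} [NormedAddCommGroup L] [NormedSpace ℝ L]
  {G : Type*} [Group G] [TopologicalSpace G] [ChartedSpace L G]
  [MulDistribMulAction Sp1 G] [MulAction G M] [MulAction Sp1 M]

/-- One-forms on `X` with values in `𝕃 = Q₊ ×_{Sp₊(1)} L`, as basic equivariant `L`-valued one-forms
on `Q`. -/
structure LieForm (S : SpinStructure g o EQ Q) (L : Type*) [NormedAddCommGroup L] [NormedSpace ℝ L]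
    (G : Type*) [Group G] [TopologicalSpace G] [ChartedSpace L G] [MulDistribMulAction Sp1 G] where
  toFun : ∀ f : Q, TangentSpace 𝓘(ℝ, EQ) f →L[ℝ] L
  smooth : ContMDiff 𝓘(ℝ, EQ).tangent 𝓘(ℝ, L) ∞
    (fun w : TangentBundle 𝓘(ℝ, EQ) Q => toFun w.1 w.2)
  horizontal : ∀ f w, mfderiv 𝓘(ℝ, EQ) (𝓡 4) S.proj f w = 0 → toFun f w = 0
  equivariant : ∀ (a : Spin4) (f : Q) (w : TangentSpace 𝓘(ℝ, EQ) f),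
    toFun (rightAct a f) (mfderiv 𝓘(ℝ, EQ) 𝓘(ℝ, EQ) (rightAct a) f w)
      = lieAct (G := G) a.1⁻¹ (toFun f w)

/-- Gauge transformations: smooth sections of `𝔾 = Q₊ ×_{Sp₊(1)} G`, as equivariant maps. -/
structure GaugeTransformation (EQ : Type*) [NormedAddCommGroup EQ] [NormedSpace ℝ EQ]
    (Q : Type*) [TopologicalSpace Q] [ChartedSpace EQ Q] [IsManifold 𝓘(ℝ, EQ) ∞ Q]
    [MulAction Spin4ᵐᵒᵖ Q]
    (L : Type*) [NormedAddCommGroup L] [NormedSpace ℝ L]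
    (G : Type*) [Group G] [TopologicalSpace G] [ChartedSpace L G] [MulDistribMulAction Sp1 G] where
  toFun : Q → G
  smooth : ContMDiff 𝓘(ℝ, EQ) 𝓘(ℝ, L) ∞ toFun
  equivariant : ∀ (a : Spin4) (f : Q), toFun (rightAct a f) = a.1⁻¹ • toFun f

/-- `(∇^φ γ) γ⁻¹` for a gauge transformation `γ`, as a one-form on `Q`. -/
def gaugeForm {S : SpinStructure g o EQ Q} (C : LeviCivita S) (γ : GaugeTransformation EQ Q L G)
    (f : Q) : TangentSpace 𝓘(ℝ, EQ) f →L[ℝ] L :=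
  (show TangentSpace (𝓡 4) (S.proj f) →L[ℝ] L from
    horizontalDeriv C (EN := L) (fun f' => γ.toFun f' * (γ.toFun f)⁻¹) f) ∘L
  mfderiv 𝓘(ℝ, EQ) (𝓡 4) S.proj f

/-- The covariant derivative `∇^B u`, where the connection `B` is given by the Levi-Civita
connection and the one-form `b`. -/
def covDeriv {S : SpinStructure g o EQ Q} (C : LeviCivita S) (u : Spinor EQ Q E M)
    (b : LieForm S L G) (f : Q) :
    TangentSpace (𝓡 4) (S.proj f) →L[ℝ] TangentSpace 𝓘(ℝ, E) (u.toFun f) :=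
  horizontalDeriv C u.toFun f + killing (G := G) (u.toFun f) ∘L b.toFun f ∘L C.lift f

/-- The generalized Dirac operator `𝒟_b u`. -/
def dirac {S : SpinStructure g o EQ Q} (C : LeviCivita S) (T : TargetData E M L G)
    (u : Spinor EQ Q E M) (b : LieForm S L G) (f : Q) :
    TangentSpace (𝓡 4) (S.proj f) →L[ℝ] TangentSpace 𝓘(ℝ, E) (u.toFun f) :=
  linearPart S (fun j => T.I j (u.toFun f)) f (covDeriv C u b f)

/-- Solutions `(u, b)` of the limiting system `𝒟_b u = 0`, `ν ∘ u = 0`. In equivariant form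
`ν ∘ u` is `μ ∘ u : Q → Im ℍ ⊗ L`. -/
structure LimitingSolution {S : SpinStructure g o EQ Q} (C : LeviCivita S)
    (T : TargetData E M L G) where
  u : Spinor EQ Q E M
  b : LieForm S L G
  dirac_eq : ∀ f, dirac C T u b f = 0
  moment_eq : ∀ f i, T.μ i (u.toFun f) = 0

/-- `(u', b')` is obtained from `(u, b)` by the action of the gauge transformation `γ`:
`u' = γ u` and `b' = Ad_γ b - (∇^φ γ) γ⁻¹`. -/
def GaugeRelated {S : SpinStructure g o EQ Q} {C : LeviCivita S} {T : TargetData E M L G}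
    (s s' : LimitingSolution C T) : Prop :=
  ∃ γ : GaugeTransformation EQ Q L G, (∀ f, s'.u.toFun f = γ.toFun f • s.u.toFun f) ∧
    ∀ f w, s'.b.toFun f w = adjoint (γ.toFun f) (s.b.toFun f w) - gaugeForm C γ f w

/-- The moduli space of solutions of the limiting system modulo gauge transformations. -/
def LimitingModuli {S : SpinStructure g o EQ Q} (C : LeviCivita S) (T : TargetData E M L G) :
    Type _ :=
  Quot (GaugeRelated (C := C) (T := T))

/-- The pure Dirac operator on spinors with values in the hyperKähler reduction. -/
def pureDirac {S : SpinStructure g o EQ Q} (C : LeviCivita S) (T : TargetData E M L G)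
    (EZ : Type*) [NormedAddCommGroup EZ] [NormedSpace ℝ EZ] [ChartedSpace EZ T.Level]
    {E₀ : Type*} [NormedAddCommGroup E₀] [NormedSpace ℝ E₀] [ChartedSpace E₀ T.Reduction]
    (v : Spinor EQ Q E₀ T.Reduction) (f : Q) :
    TangentSpace (𝓡 4) (S.proj f) →L[ℝ] TangentSpace 𝓘(ℝ, E₀) (v.toFun f) :=
  linearPart S (fun j => T.reducedI EZ E₀ j (v.toFun f)) f (horizontalDeriv C v.toFun f)

/-- The pulled-back bundle `v^* μ⁻¹(0) → Q₊` is trivial, i.e. isomorphic to `G × Q₊` as a `G`-bundle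
carrying a compatible action of `Sp₊(1)`. The isomorphism covers the identity and sends `(g, f)` to
`(f, ψ g f)`; a map between principal `G`-bundles of this kind is automatically invertible. -/
def HasTrivialPullback (T : TargetData E M L G)
    (EZ : Type*) [NormedAddCommGroup EZ] [NormedSpace ℝ EZ] [ChartedSpace EZ T.Level]
    {E₀ : Type*} [NormedAddCommGroup E₀] [NormedSpace ℝ E₀] [ChartedSpace E₀ T.Reduction]
    (v : Spinor EQ Q E₀ T.Reduction) : Prop :=
  ∃ ψ : G → Q → T.Level,
    ContMDiff (𝓘(ℝ, L).prod 𝓘(ℝ, EQ)) 𝓘(ℝ, EZ) ∞ (fun z : G × Q => ψ z.1 z.2) ∧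
    (∀ h f, T.toReduction (ψ h f) = v.toFun f) ∧
    (∀ k h f, ψ (k * h) f = k • ψ h f) ∧
    (∀ (a : Spin4) h f, ψ (a.1⁻¹ • h) (rightAct a f) = a.1⁻¹ • ψ h f)

/-- The space `ℋ₀(𝕄₀)` of pure harmonic spinors with values in the reduction whose pulled-back
`G`-bundle is trivial. -/
def HarmonicSpinors {S : SpinStructure g o EQ Q} (C : LeviCivita S) (T : TargetData E M L G)
    (EZ : Type*) [NormedAddCommGroup EZ] [NormedSpace ℝ EZ] [ChartedSpace EZ T.Level]
    (E₀ : Type*) [NormedAddCommGroup E₀] [NormedSpace ℝ E₀] [ChartedSpace E₀ T.Reduction] :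
    Type _ :=
  {v : Spinor EQ Q E₀ T.Reduction // HasTrivialPullback T EZ v ∧ ∀ f, pureDirac C T EZ v f = 0}

end Spinors

end

/-!
A solution `(u, b)` takes values in the level set `μ⁻¹(0)`, so that its covariant derivative
`A = ∇^B u` takes values in `ker dμ`: the derivative of `u` does, and so do the Killing vectors. The
moment map equation `⟨dμ_i, ξ⟩ = ⟨I_i K_ξ, ·⟩` says that each `I_j` maps `ker dμ` into the
orthogonal complement of the orbit (`TargetData.Tan.hor_cplx`). The Dirac equation reads
`A = Σ_j I_j A J_j`, and hence forces `A` to be orthogonal to the orbit. Conversely, the horizontal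
part of
`ker dμ` is stable under the `I_j` and is identified by `dπ`, `π : μ⁻¹(0) → M₀`, with the tangent
space of the reduction, where the `I_j` induce the complex structures. Since `dπ` annihilates the
Killing vectors, `dπ ∘ A` is the covariant derivative of `π ∘ u`. This gives the central
equivalence `dirac_eq_zero_iff`: for `u` with values in `μ⁻¹(0)`, the Dirac equation holds if and
only if `A` is horizontal and `π ∘ u` is a pure harmonic spinor.

The infinitesimal action is injective along `μ⁻¹(0)` because `0` is a regular value, so
horizontality of `A` determines `b` (`TargetData.eq_of_hor_add_kill`): it is minus the pull-back
along `u` of the connection form on `μ⁻¹(0)` given by the orthogonal projection to the orbits,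
restricted to the Levi-Civita horizontal vectors. This expression always defines a smooth
equivariant form (`pullbackForm`).

Therefore the map on solutions is surjective: a trivialization of the pulled-back bundle is the
same as an equivariant lift `u` of `v`, namely the image of the unit section, and `pullbackForm`
completes it to a solution (`exists_toHarmonicSpinor_eq`). Its fibres are the gauge orbits
(`gaugeRelated_iff`): two lifts of `v` differ by a unique map to `G`, which freeness makes
equivariant and local triviality makes smooth (`exists_gaugeTransformation`), and as gauge
transformations preserve horizontality (`tderiv_gauge`), uniqueness of `b` takes care of the
forms.
-/

open Filter Topology

set_option synthInstance.maxHeartbeats 200000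

/-! ### Differentials of maps between manifolds -/

section Differentials

variable {E E' E'' : Type*} [NormedAddCommGroup E] [NormedSpace ℝ E]
  [NormedAddCommGroup E'] [NormedSpace ℝ E'] [NormedAddCommGroup E''] [NormedSpace ℝ E'']
  {M N P : Type*} [TopologicalSpace M] [ChartedSpace E M] [TopologicalSpace N] [ChartedSpace E' N]
  [TopologicalSpace P] [ChartedSpace E'' P]

/-- The differential of a map between manifolds modelled on `E` and `E'`, as a linear map `E → E'`.
All tangent spaces of a manifold modelled on `E` are copies of `E`, so this is `mfderiv` with the
base points removed from its type. -/
noncomputable def tderiv (E E' : Type*) [NormedAddCommGroup E] [NormedSpace ℝ E]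
    [NormedAddCommGroup E'] [NormedSpace ℝ E'] {M N : Type*} [TopologicalSpace M] [ChartedSpace E M]
    [TopologicalSpace N] [ChartedSpace E' N] (f : M → N) (x : M) : E →L[ℝ] E' :=
  mfderiv 𝓘(ℝ, E) 𝓘(ℝ, E') f x

lemma tderiv_comp {g : N → P} {f : M → N} {x : M}
    (hg : MDifferentiableAt 𝓘(ℝ, E') 𝓘(ℝ, E'') g (f x))
    (hf : MDifferentiableAt 𝓘(ℝ, E) 𝓘(ℝ, E') f x) (v : E) :
    tderiv E E'' (fun y => g (f y)) x v = tderiv E' E'' g (f x) (tderiv E E' f x v) := by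
  have h := mfderiv_comp x hg hf
  exact congrArg (fun A : E →L[ℝ] E'' => A v) h

lemma tderiv_const (c : N) (x : M) : tderiv E E' (fun _ : M => c) x = 0 :=
  mfderiv_const

lemma tderiv_id (x : M) : tderiv E E (fun y : M => y) x = ContinuousLinearMap.id ℝ E :=
  mfderiv_id

lemma tderiv_congr {f g : M → N} {x : M} (h : f =ᶠ[𝓝 x] g) :
    tderiv E E' f x = tderiv E E' g x :=
  h.mfderiv_eq

/-- The chain rule for a function of two variables, in terms of its partial differentials. -/
lemma tderiv_comp₂ {E₃ : Type*} [NormedAddCommGroup E₃] [NormedSpace ℝ E₃]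
    {R : Type*} [TopologicalSpace R] [ChartedSpace E₃ R]
    {F : N → P → R} {a : M → N} {b : M → P} {x : M}
    (hF : MDifferentiableAt (𝓘(ℝ, E').prod 𝓘(ℝ, E'')) 𝓘(ℝ, E₃) (fun z : N × P => F z.1 z.2)
      (a x, b x))
    (ha : MDifferentiableAt 𝓘(ℝ, E) 𝓘(ℝ, E') a x)
    (hb : MDifferentiableAt 𝓘(ℝ, E) 𝓘(ℝ, E'') b x) (v : E) :
    tderiv E E₃ (fun y => F (a y) (b y)) x v
      = tderiv E' E₃ (fun n => F n (b x)) (a x) (tderiv E E' a x v)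
        + tderiv E'' E₃ (fun p => F (a x) p) (b x) (tderiv E E'' b x v) := by
  have h1 := mfderiv_comp (I := 𝓘(ℝ, E)) x hF (ha.prodMk hb)
  have h2 := mfderiv_prod_eq_add_apply hF
    (v := mfderiv 𝓘(ℝ, E) (𝓘(ℝ, E').prod 𝓘(ℝ, E'')) (fun y => (a y, b y)) x v)
  have h3 := mfderiv_prodMk ha hb
  rw [h3] at h2
  refine (congrArg (fun A : E →L[ℝ] E₃ => A v) h1).trans ?_
  refine Eq.trans ?_ h2
  rw [← h3]
  rfl

end Differentials

/-! ### Tangent spaces of level sets -/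

section ImplicitCurve

variable {E V : Type*} [NormedAddCommGroup E] [NormedSpace ℝ E] [FiniteDimensional ℝ E]
  [NormedAddCommGroup V] [NormedSpace ℝ V] [FiniteDimensional ℝ V]

/-- Every vector in the kernel of a surjective differential is the velocity of a smooth curve in the
level set. -/
lemma ContDiffAt.exists_curve_in_level {f : E → V} {x : E} (hf : ContDiffAt ℝ ∞ f x)
    (hs : Function.Surjective (fderiv ℝ f x)) {v : E} (hv : fderiv ℝ f x v = 0) :
    ∃ c : ℝ → E, ContDiffAt ℝ ∞ c 0 ∧ c 0 = x ∧ HasDerivAt c v 0 ∧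
      ∀ᶠ t in 𝓝 (0 : ℝ), f (c t) = f x := by
  have hst : HasStrictFDerivAt f (fderiv ℝ f x) x := hf.hasStrictFDerivAt (by simp)
  have hr : (fderiv ℝ f x).range = ⊤ := LinearMap.range_eq_top.2 hs
  have hk : (fderiv ℝ f x).ker.ClosedComplemented :=
    Submodule.ClosedComplemented.of_finiteDimensional _
  have : CompleteSpace E := FiniteDimensional.complete ℝ E
  have : CompleteSpace V := FiniteDimensional.complete ℝ V
  let w : (fderiv ℝ f x).ker := ⟨v, hv⟩
  let ψ := hst.implicitFunction f (fderiv ℝ f x) hr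
  let l : ℝ → (fderiv ℝ f x).ker := fun t => t • w
  have hl : ContDiff ℝ ∞ l := contDiff_id.smul contDiff_const
  have hl' : HasDerivAt l w 0 := by simpa using (hasDerivAt_id (0 : ℝ)).smul_const w
  have hl0 : l 0 = 0 := zero_smul _ _
  refine ⟨fun t => ψ (f x) (l t), ?_, ?_, ?_, ?_⟩
  · let φ := HasStrictFDerivAt.implicitFunctionDataOfComplemented f (fderiv ℝ f x) hst hr hk
    have h1 : ContDiffAt ℝ ∞ φ.implicitFunction.uncurry (φ.prodFun φ.pt) := by
      refine ImplicitFunctionData.contDiffAt_implicitFunction hf ?_ (by simp)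
      exact (ContinuousLinearMap.contDiff _).contDiffAt.comp _ (contDiffAt_id.sub contDiffAt_const)
    have h2 : φ.prodFun φ.pt = (f x, l 0) := by
      simp [φ, ImplicitFunctionData.prodFun, HasStrictFDerivAt.implicitFunctionDataOfComplemented,
        hl0]
    rw [h2] at h1
    exact ContDiffAt.comp (g := φ.implicitFunction.uncurry) (f := fun t => (f x, l t)) (0 : ℝ) h1
      (contDiffAt_const.prodMk hl.contDiffAt)
  · simp only [hl0]
    exact hst.implicitFunction_apply_image hr
  · have h := (hst.to_implicitFunction hr).hasFDerivAt
    rw [← hl0] at h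
    exact h.comp_hasDerivAt (0 : ℝ) hl'
  · have h := hst.map_implicitFunction_eq hr
    have ht : Tendsto (fun t => (f x, l t)) (𝓝 (0 : ℝ)) (𝓝 (f x, 0)) := by
      rw [← hl0]
      exact (continuous_const.prodMk hl.continuous).tendsto 0
    exact ht.eventually h

end ImplicitCurve

section LevelSet

variable {E V E' : Type*} [NormedAddCommGroup E] [NormedSpace ℝ E] [FiniteDimensional ℝ E]
  [NormedAddCommGroup V] [NormedSpace ℝ V] [FiniteDimensional ℝ V]
  [NormedAddCommGroup E'] [NormedSpace ℝ E']
  {M : Type*} [TopologicalSpace M] [ChartedSpace E M] [IsManifold 𝓘(ℝ, E) ∞ M]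

/-- The tangent space of an embedded level set contains the kernel of a surjective differential. -/
lemma exists_tderiv_val_eq {p : M → Prop} [ChartedSpace E' {m // p m}]
    [IsManifold 𝓘(ℝ, E') ∞ {m // p m}]
    (hsub : Manifold.IsSmoothEmbedding 𝓘(ℝ, E') 𝓘(ℝ, E) ∞ (Subtype.val : {m // p m} → M))
    {F : M → V} (hF : ContMDiff 𝓘(ℝ, E) 𝓘(ℝ, V) ∞ F) (z : {m // p m})
    (hp : ∀ m, F m = F z.1 → p m)
    (hs : Function.Surjective (tderiv E V F z.1)) {v : E} (hv : tderiv E V F z.1 v = 0) :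
    ∃ w : E', tderiv E' E (Subtype.val : {m // p m} → M) z w = v := by
  classical
  set φ := extChartAt 𝓘(ℝ, E) z.1
  have hφ : (φ : M → E) z.1 ∈ φ.target := mem_extChartAt_target z.1
  have hto : φ.target ∈ 𝓝 (φ z.1) := extChartAt_target_mem_nhds z.1
  have hsymm : ContMDiffAt 𝓘(ℝ, E) 𝓘(ℝ, E) ∞ φ.symm (φ z.1) :=
    (contMDiffOn_extChartAt_symm z.1).contMDiffAt hto
  have hleft : φ.symm (φ z.1) = z.1 := extChartAt_to_inv z.1
  have hFd : tderiv E V F z.1 = fderiv ℝ (fun e => F (φ.symm e)) (φ z.1) := by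
    have h := (hF.mdifferentiableAt (x := z.1) (by simp)).mfderiv
    refine h.trans ?_
    simp only [writtenInExtChartAt, extChartAt_model_space_eq_id, modelWithCornersSelf_coe,
      Set.range_id, fderivWithin_univ, PartialEquiv.refl_coe]
    rfl
  have hf : ContDiffAt ℝ ∞ (fun e => F (φ.symm e)) (φ z.1) := by
    have : ContMDiffAt 𝓘(ℝ, E) 𝓘(ℝ, V) ∞ (fun e => F (φ.symm e)) (φ z.1) :=
      ContMDiffAt.comp _ hF.contMDiffAt hsymm
    exact this.contDiffAt
  rw [hFd] at hs hv
  obtain ⟨c, hc, hc0, hcd, hcF⟩ := hf.exists_curve_in_level hs hv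
  rw [hleft] at hcF
  -- far from `t = 0` the curve need not stay in the level set, so a default value is prescribed
  let d : ℝ → {m // p m} := fun t => if h : p (φ.symm (c t)) then ⟨φ.symm (c t), h⟩ else z
  have hd : (fun t => (d t).1) =ᶠ[𝓝 0] fun t => φ.symm (c t) := by
    filter_upwards [hcF] with t ht
    simp only [d, dif_pos (hp _ ht)]
  have hd0 : d 0 = z := by
    apply Subtype.ext
    rw [hd.eq_of_nhds, hc0, hleft]
  have hcs : ContMDiffAt 𝓘(ℝ, ℝ) 𝓘(ℝ, E) ∞ (fun t => φ.symm (c t)) 0 := by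
    have h1 : ContMDiffAt 𝓘(ℝ, E) 𝓘(ℝ, E) ∞ φ.symm (c 0) := by rw [hc0]; exact hsymm
    exact ContMDiffAt.comp _ h1 hc.contMDiffAt
  have hvd : ContMDiffAt 𝓘(ℝ, ℝ) 𝓘(ℝ, E) ∞ (fun t => (d t).1) 0 :=
    hcs.congr_of_eventuallyEq hd
  have hdc : ContinuousAt d 0 :=
    hsub.isEmbedding.continuousAt_iff.2 hvd.continuousAt
  have hds : ContMDiffAt 𝓘(ℝ, ℝ) 𝓘(ℝ, E') ∞ d 0 :=
    (ContMDiffAt.iff_comp_isImmersionAt (hsub.isImmersion.isImmersionAt _)).2 ⟨hdc, hvd⟩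
  have hval : ContMDiff 𝓘(ℝ, E') 𝓘(ℝ, E) ∞ (Subtype.val : {m // p m} → M) := hsub.contMDiff
  refine ⟨tderiv ℝ E' d 0 (1 : ℝ), ?_⟩
  have h1 := tderiv_comp (E := ℝ) (E' := E') (E'' := E) (g := (Subtype.val : {m // p m} → M))
    (f := d) (x := (0 : ℝ))
    (hval.mdifferentiableAt (by simp)) (hds.mdifferentiableAt (by simp)) (1 : ℝ)
  rw [hd0] at h1
  rw [← h1, tderiv_congr hd]
  have hcm : MDifferentiableAt 𝓘(ℝ, ℝ) 𝓘(ℝ, E) (fun t => φ.symm (c t)) 0 :=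
    hcs.mdifferentiableAt (by simp)
  have h2 : HasMFDerivAt 𝓘(ℝ, ℝ) 𝓘(ℝ, E) (fun t => φ.symm (c t)) 0
      (ContinuousLinearMap.toSpanSingleton ℝ v) := by
    refine ⟨hcs.continuousAt, ?_⟩
    have hw : writtenInExtChartAt 𝓘(ℝ, ℝ) 𝓘(ℝ, E) (0 : ℝ) (fun t => φ.symm (c t)) =ᶠ[𝓝 0] c := by
      have : ∀ᶠ t in 𝓝 (0 : ℝ), c t ∈ φ.target :=
        hc.continuousAt.eventually (by rw [hc0]; exact hto)
      filter_upwards [this] with t ht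
      simp only [writtenInExtChartAt, extChartAt_model_space_eq_id, Function.comp,
        PartialEquiv.refl_symm, PartialEquiv.refl_coe, id, hc0, hleft]
      exact φ.right_inv ht
    simp only [extChartAt_model_space_eq_id, PartialEquiv.refl_coe, id, modelWithCornersSelf_coe,
      Set.range_id]
    exact (hcd.hasFDerivAt.congr_of_eventuallyEq hw).hasFDerivWithinAt
  have h3 : tderiv ℝ E (fun t => φ.symm (c t)) (0 : ℝ)
      = ContinuousLinearMap.toSpanSingleton ℝ v := h2.mfderiv
  rw [h3]
  simp

end LevelSet

/-! ### The adjoint action and the induced action on the Lie algebra -/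

section GroupDifferentials

variable {L : Type*} [NormedAddCommGroup L] [NormedSpace ℝ L]
  {G : Type*} [Group G] [TopologicalSpace G] [ChartedSpace L G] [LieGroup 𝓘(ℝ, L) ∞ G]

lemma mdifferentiable_conj (g : G) :
    MDifferentiable 𝓘(ℝ, L) 𝓘(ℝ, L) (fun h : G => g * h * g⁻¹) :=
  ((contMDiff_const.mul contMDiff_id).mul contMDiff_const :
    ContMDiff 𝓘(ℝ, L) 𝓘(ℝ, L) ∞ (fun h : G => g * h * g⁻¹)).mdifferentiable (by simp)

lemma adjoint_adjoint_inv (g : G) (ξ : L) : adjoint g (adjoint g⁻¹ ξ) = ξ := by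
  have h := tderiv_comp (E := L) (E' := L) (E'' := L) (g := fun h : G => g * h * g⁻¹)
    (f := fun h : G => g⁻¹ * h * g⁻¹⁻¹) (x := 1)
    (mdifferentiable_conj g _) (mdifferentiable_conj g⁻¹ _) ξ
  have h1 : (fun y : G => g * (g⁻¹ * y * g⁻¹⁻¹) * g⁻¹) = fun y => y := by
    funext y; group
  rw [h1, tderiv_id] at h
  simp only [mul_one, mul_inv_cancel] at h
  exact h.symm

variable [MulDistribMulAction Sp1 G]

omit [LieGroup 𝓘(ℝ, L) ∞ G] in
lemma lieAct_lieAct_inv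
    (hs : ContMDiff ((𝓡 3).prod 𝓘(ℝ, L)) 𝓘(ℝ, L) ∞ (fun z : Sp1 × G => z.1 • z.2))
    (q : Sp1) (ξ : L) : lieAct (G := G) q (lieAct (G := G) q⁻¹ ξ) = ξ := by
  have hd : ∀ q : Sp1, MDifferentiable 𝓘(ℝ, L) 𝓘(ℝ, L) (fun h : G => q • h) := fun q =>
    (hs.comp (contMDiff_const.prodMk contMDiff_id) :
      ContMDiff 𝓘(ℝ, L) 𝓘(ℝ, L) ∞ (fun h : G => q • h)).mdifferentiable (by simp)
  have h := tderiv_comp (E := L) (E' := L) (E'' := L) (g := fun h : G => q • h)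
    (f := fun h : G => q⁻¹ • h) (x := 1) (hd q _) (hd q⁻¹ _) ξ
  simp only [smul_inv_smul, tderiv_id, smul_one] at h
  exact h.symm

end GroupDifferentials

namespace TargetData

variable {E : Type*} [NormedAddCommGroup E] [NormedSpace ℝ E]
  {M : Type*} [TopologicalSpace M] [ChartedSpace E M] [IsManifold 𝓘(ℝ, E) ∞ M]
  {L : Type*} [NormedAddCommGroup L] [NormedSpace ℝ L]
  {G : Type*} [Group G] [TopologicalSpace G] [ChartedSpace L G]
  [MulDistribMulAction Sp1 G] [MulAction G M] [MulAction Sp1 M]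
  (T : TargetData E M L G)

/-! ### Linear algebra of the momentum map -/

/-- The complex structure `I_j` at `m`, as an endomorphism of the model space. -/
noncomputable def cplx (j : Fin 3) (m : M) : E →L[ℝ] E := T.I j m

/-- The Riemannian metric at `m`, as a bilinear form on the model space. -/
noncomputable def gm (m : M) : E →L[ℝ] E →L[ℝ] ℝ := T.metric.inner m

/-- The infinitesimal action `ξ ↦ K_ξ(m)`, with values in the model space. -/
noncomputable def kill (_ : TargetData E M L G) (m : M) : L →L[ℝ] E := killing (G := G) m

lemma kill_eq (m : M) : T.kill m = tderiv L E (fun g : G => g • m) 1 := rfl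

/-- `v` is orthogonal to the `G`-orbit of `m`. -/
def Hor (m : M) (v : E) : Prop := ∀ ξ : L, T.gm m v (T.kill m ξ) = 0

/-- `v` is in the kernel of the differential of the momentum map at `m`. -/
def Tan (m : M) (v : E) : Prop := ∀ i, tderiv E L (T.μ i) m v = 0

variable {T}

lemma gm_symm (m : M) (v w : E) : T.gm m v w = T.gm m w v := T.metric.symm m v w

lemma eq_zero_of_gm_self {m : M} {v : E} (h : T.gm m v v = 0) : v = 0 := by
  by_contra hv
  exact (T.metric.pos m v hv).ne' h

lemma cplx_cplx_self (j : Fin 3) (m : M) (v : E) : T.cplx j m (T.cplx j m v) = -v := T.I_sq j m v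

lemma cplx_zero_one (m : M) (v : E) : T.cplx 0 m (T.cplx 1 m v) = T.cplx 2 m v := T.I_mul m v

lemma gm_cplx_cplx (j : Fin 3) (m : M) (v w : E) :
    T.gm m (T.cplx j m v) (T.cplx j m w) = T.gm m v w := T.I_orthogonal j m v w

lemma gm_cplx_left (j : Fin 3) (m : M) (v w : E) :
    T.gm m (T.cplx j m v) w = -T.gm m v (T.cplx j m w) := by
  rw [← T.gm_cplx_cplx j m v (T.cplx j m w), cplx_cplx_self, map_neg, neg_neg]

/-- The product of two of the complex structures is `-1` or, up to sign, another one. -/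
lemma cplx_mul_cases (i j : Fin 3) (m : M) :
    (∀ v, T.cplx i m (T.cplx j m v) = -v) ∨
      ∃ (k : Fin 3) (s : ℝ), ∀ v, T.cplx i m (T.cplx j m v) = s • T.cplx k m v := by
  have h01 := T.cplx_zero_one m
  have h12 (v : E) : T.cplx 1 m (T.cplx 2 m v) = T.cplx 0 m v := by
    have h := congrArg (T.cplx 0 m) (h01 (T.cplx 2 m v))
    rw [cplx_cplx_self, cplx_cplx_self, map_neg] at h
    exact neg_injective h
  have h10 (v : E) : T.cplx 1 m (T.cplx 0 m v) = -T.cplx 2 m v := by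
    rw [← h12, cplx_cplx_self]
  have h02 (v : E) : T.cplx 0 m (T.cplx 2 m v) = -T.cplx 1 m v := by
    rw [← h01, cplx_cplx_self]
  have h21 (v : E) : T.cplx 2 m (T.cplx 1 m v) = -T.cplx 0 m v := by
    rw [← h01, cplx_cplx_self, map_neg]
  have h20 (v : E) : T.cplx 2 m (T.cplx 0 m v) = T.cplx 1 m v := by
    rw [← h12, h21, h02, neg_neg]
  fin_cases i <;> fin_cases j
  · exact Or.inl (cplx_cplx_self 0 m)
  · exact Or.inr ⟨2, 1, fun v => by simpa using h01 v⟩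
  · exact Or.inr ⟨1, -1, fun v => by simpa using h02 v⟩
  · exact Or.inr ⟨2, -1, fun v => by simpa using h10 v⟩
  · exact Or.inl (cplx_cplx_self 1 m)
  · exact Or.inr ⟨0, 1, fun v => by simpa using h12 v⟩
  · exact Or.inr ⟨1, 1, fun v => by simpa using h20 v⟩
  · exact Or.inr ⟨0, -1, fun v => by simpa using h21 v⟩
  · exact Or.inl (cplx_cplx_self 2 m)

lemma ip_tderiv_moment (i : Fin 3) (m : M) (ξ : L) (v : E) :
    T.ip (tderiv E L (T.μ i) m v) ξ = T.gm m (T.cplx i m (T.kill m ξ)) v := T.μ_moment i m ξ v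

lemma eq_zero_of_ip_eq_zero {ξ : L} (h : ∀ η, T.ip ξ η = 0) : ξ = 0 := by
  by_contra hne
  exact (T.ip_pos ξ hne).ne' (h ξ)

lemma tan_iff {m : M} {v : E} :
    T.Tan m v ↔ ∀ i ξ, T.gm m (T.cplx i m (T.kill m ξ)) v = 0 := by
  refine ⟨fun h i ξ => ?_, fun h i => eq_zero_of_ip_eq_zero (T := T) fun ξ => ?_⟩
  · rw [← T.ip_tderiv_moment, h i, map_zero, LinearMap.zero_apply]
  · rw [ip_tderiv_moment, h]

/-- The horizontal vectors in the kernel of the differential of the momentum map form a complex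
subspace, for each of the three complex structures. -/
lemma Tan.cplx {m : M} {v : E} (ht : T.Tan m v) (hh : T.Hor m v) (j : Fin 3) :
    T.Tan m (T.cplx j m v) := by
  rw [tan_iff] at ht ⊢
  intro i ξ
  rw [gm_symm, gm_cplx_left, neg_eq_zero]
  rcases T.cplx_mul_cases j i m with h | ⟨k, s, h⟩
  · rw [h, map_neg, hh, neg_zero]
  · rw [h, map_smul, gm_symm, ht, smul_zero]

/-- A complex structure maps the kernel of the differential of the momentum map into the orthogonal
complement of the orbit. -/
lemma Tan.hor_cplx {m : M} {v : E} (ht : T.Tan m v) (j : Fin 3) : T.Hor m (T.cplx j m v) := by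
  rw [tan_iff] at ht
  intro ξ
  rw [gm_cplx_left, gm_symm, ht, neg_zero]

lemma Hor.add {m : M} {v w : E} (hv : T.Hor m v) (hw : T.Hor m w) : T.Hor m (v + w) := fun ξ => by
  rw [map_add, add_apply, hv, hw, add_zero]

lemma Hor.sub {m : M} {v w : E} (hv : T.Hor m v) (hw : T.Hor m w) : T.Hor m (v - w) := fun ξ => by
  rw [map_sub, sub_apply, hv, hw, sub_zero]

/-- At a regular point the infinitesimal action is injective: if `K_ξ = 0`, then `ξ` is orthogonal
to the range of `dμ_1`, which is all of `L`. -/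
lemma kill_injective (hreg : T.ZeroIsRegular) {m : M} (hm : ∀ i, T.μ i m = 0) :
    Function.Injective (T.kill m) := by
  rw [injective_iff_map_eq_zero]
  intro ξ hξ
  obtain ⟨v, hv0⟩ : ∃ v : E, tderiv E L (T.μ 0) m v = ξ := by
    obtain ⟨v, hv⟩ := hreg m hm (fun _ => ξ)
    exact ⟨v, congrFun hv 0⟩
  have h := T.ip_tderiv_moment 0 m ξ v
  rw [hv0, hξ, map_zero, map_zero, zero_apply] at h
  by_contra hne
  exact (T.ip_pos ξ hne).ne' h

lemma Hor.eq_zero_of_eq_kill {m : M} {ξ : L} (h : T.Hor m (T.kill m ξ)) : T.kill m ξ = 0 :=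
  eq_zero_of_gm_self (h ξ)

/-! ### Differentials of the group actions -/

section Actions

lemma contMDiff_smul_left (T : TargetData E M L G) (g : G) :
    ContMDiff 𝓘(ℝ, E) 𝓘(ℝ, E) ∞ (fun m : M => g • m) :=
  T.smooth_G.comp (contMDiff_const.prodMk contMDiff_id)

lemma contMDiff_smul_right (T : TargetData E M L G) (m : M) :
    ContMDiff 𝓘(ℝ, L) 𝓘(ℝ, E) ∞ (fun g : G => g • m) :=
  T.smooth_G.comp (contMDiff_id.prodMk contMDiff_const)

lemma contMDiff_Sp1_smul_left (T : TargetData E M L G) (q : Sp1) :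
    ContMDiff 𝓘(ℝ, E) 𝓘(ℝ, E) ∞ (fun m : M => q • m) :=
  T.smooth_Sp1.comp (contMDiff_const.prodMk contMDiff_id)

lemma gm_tderiv_smul (g : G) (m : M) (v w : E) :
    T.gm (g • m) (tderiv E E (fun m : M => g • m) m v) (tderiv E E (fun m : M => g • m) m w)
      = T.gm m v w := T.isometric_G g m v w

lemma gm_tderiv_Sp1_smul (q : Sp1) (m : M) (v w : E) :
    T.gm (q • m) (tderiv E E (fun m : M => q • m) m v) (tderiv E E (fun m : M => q • m) m w)
      = T.gm m v w := T.isometric_Sp1 q m v w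

lemma tderiv_smul_cplx (g : G) (j : Fin 3) (m : M) (v : E) :
    tderiv E E (fun m : M => g • m) m (T.cplx j m v)
      = T.cplx j (g • m) (tderiv E E (fun m : M => g • m) m v) := T.holomorphic_G g j m v

variable [LieGroup 𝓘(ℝ, L) ∞ G]

/-- The action of `g` maps the Killing field of `ξ` to that of `Ad_g ξ`. -/
lemma tderiv_smul_kill (g : G) (m : M) (ξ : L) :
    tderiv E E (fun m : M => g • m) m (T.kill m ξ) = T.kill (g • m) (adjoint g ξ) := by
  have h1 := tderiv_comp (E := L) (E' := E) (E'' := E) (g := fun m : M => g • m)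
    (f := fun h : G => h • m) (x := 1)
    ((T.contMDiff_smul_left g).mdifferentiable (by simp) _)
    ((T.contMDiff_smul_right m).mdifferentiable (by simp) _) ξ
  have h2 := tderiv_comp (E := L) (E' := L) (E'' := E) (g := fun k : G => k • (g • m))
    (f := fun h : G => g * h * g⁻¹) (x := 1)
    ((T.contMDiff_smul_right _).mdifferentiable (by simp) _) (mdifferentiable_conj g _) ξ
  have h3 : (fun y : G => g • y • m) = fun y : G => (g * y * g⁻¹) • g • m := by
    funext y; simp [mul_smul]
  rw [one_smul] at h1
  simp only [mul_one, mul_inv_cancel] at h2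
  exact h1.symm.trans ((congrArg (fun f : G → M => tderiv L E f 1 ξ) h3).trans h2)

omit [LieGroup 𝓘(ℝ, L) ∞ G] in
/-- The action of `q ∈ Sp(1)` maps the Killing field of `ξ` to that of `q • ξ`. -/
lemma tderiv_Sp1_smul_kill (q : Sp1) (m : M) (ξ : L) :
    tderiv E E (fun m : M => q • m) m (T.kill m ξ) = T.kill (q • m) (lieAct (G := G) q ξ) := by
  have hq : ContMDiff 𝓘(ℝ, L) 𝓘(ℝ, L) ∞ (fun h : G => q • h) :=
    T.smooth_aut.comp (contMDiff_const.prodMk contMDiff_id)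
  have h1 := tderiv_comp (E := L) (E' := E) (E'' := E) (g := fun m : M => q • m)
    (f := fun h : G => h • m) (x := 1)
    ((T.contMDiff_Sp1_smul_left q).mdifferentiable (by simp) _)
    ((T.contMDiff_smul_right m).mdifferentiable (by simp) _) ξ
  have h2 := tderiv_comp (E := L) (E' := L) (E'' := E) (g := fun k : G => k • (q • m))
    (f := fun h : G => q • h) (x := 1)
    ((T.contMDiff_smul_right _).mdifferentiable (by simp) _) (hq.mdifferentiable (by simp) _) ξ
  have h3 : (fun y : G => q • y • m) = fun y : G => (q • y) • q • m := by
    funext y; exact T.semidirect q y m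
  rw [one_smul] at h1
  simp only [smul_one] at h2
  exact h1.symm.trans ((congrArg (fun f : G → M => tderiv L E f 1 ξ) h3).trans h2)

lemma Hor.smul {m : M} {v : E} (hv : T.Hor m v) (g : G) :
    T.Hor (g • m) (tderiv E E (fun m : M => g • m) m v) := fun ξ => by
  rw [← adjoint_adjoint_inv g ξ, ← tderiv_smul_kill, gm_tderiv_smul, hv]

omit [LieGroup 𝓘(ℝ, L) ∞ G] in
lemma Hor.Sp1_smul {m : M} {v : E} (hv : T.Hor m v) (q : Sp1) :
    T.Hor (q • m) (tderiv E E (fun m : M => q • m) m v) := fun ξ => by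
  rw [← lieAct_lieAct_inv T.smooth_aut q ξ, ← tderiv_Sp1_smul_kill, gm_tderiv_Sp1_smul, hv]

end Actions

/-! ### The orthogonal projection onto the orbits -/

section Connection

variable [FiniteDimensional ℝ L]

variable (T)

/-- The scalar products of a vector with the Killing vectors, assembled into an element of `L` by
means of a basis. -/
noncomputable def coef (m : M) : E →L[ℝ] L :=
  ∑ a, ((T.gm m).flip (T.kill m (Module.finBasis ℝ L a))).smulRight (Module.finBasis ℝ L a)

/-- The connection form at `m`: it sends `v` to the element of `L` whose Killing vector is the
orthogonal projection of `v` to the orbit, provided that the infinitesimal action is injective. -/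
noncomputable def connForm (m : M) : E →L[ℝ] L :=
  Ring.inverse (T.coef m ∘L T.kill m) ∘L T.coef m

variable {T}

lemma coef_apply (m : M) (v : E) :
    T.coef m v = ∑ a, T.gm m v (T.kill m (Module.finBasis ℝ L a)) • Module.finBasis ℝ L a := by
  simp [coef]

lemma hor_iff_coef {m : M} {v : E} : T.Hor m v ↔ T.coef m v = 0 := by
  rw [coef_apply]
  refine ⟨fun h => Finset.sum_eq_zero fun a _ => by rw [h, zero_smul], fun h ξ => ?_⟩
  have h' := Fintype.linearIndependent_iff.1 (Module.finBasis ℝ L).linearIndependent _ h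
  have : (T.gm m v ∘L T.kill m).toLinearMap = 0 := (Module.finBasis ℝ L).ext fun a => h' a
  exact LinearMap.congr_fun this ξ

/-- The Gram operator of the Killing vectors is invertible, the metric being definite on the orbit.
-/
lemma isUnit_gram {m : M} (hinj : Function.Injective (T.kill m)) :
    IsUnit (T.coef m ∘L T.kill m) := by
  have hi : Function.Injective (T.coef m ∘L T.kill m).toLinearMap := by
    rw [injective_iff_map_eq_zero]
    intro ξ hξ
    exact (map_eq_zero_iff _ hinj).1 (hor_iff_coef.2 hξ).eq_zero_of_eq_kill
  let e := LinearEquiv.ofInjectiveEndo _ hi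
  exact ⟨ContinuousLinearEquiv.toUnit e.toContinuousLinearEquiv, rfl⟩

lemma hor_sub_kill_connForm {m : M} (hinj : Function.Injective (T.kill m)) (v : E) :
    T.Hor m (v - T.kill m (T.connForm m v)) := by
  rw [hor_iff_coef, map_sub, sub_eq_zero]
  have h := Ring.mul_inverse_cancel _ (isUnit_gram hinj)
  exact (congrArg (fun A : L →L[ℝ] L => A (T.coef m v)) h).symm

omit [FiniteDimensional ℝ L] in
/-- There is at most one element of `L` whose Killing vector makes a given vector horizontal. -/
lemma eq_of_hor_add_kill {m : M} (hinj : Function.Injective (T.kill m)) {v : E} {ξ η : L}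
    (h₁ : T.Hor m (v + T.kill m ξ)) (h₂ : T.Hor m (v + T.kill m η)) : ξ = η := by
  have h := h₁.sub h₂
  rw [add_sub_add_left_eq_sub, ← map_sub] at h
  exact sub_eq_zero.1 ((map_eq_zero_iff _ hinj).1 h.eq_zero_of_eq_kill)

/-! ### Smoothness of the connection form -/

omit [FiniteDimensional ℝ L] in
lemma contMDiff_kill [LieGroup 𝓘(ℝ, L) ∞ G] (ξ : L) :
    ContMDiff 𝓘(ℝ, E) 𝓘(ℝ, E).tangent ∞
      (fun m : M => (⟨m, T.kill m ξ⟩ : TangentBundle 𝓘(ℝ, E) M)) := by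
  have h1 : ContMDiff (𝓘(ℝ, L).prod 𝓘(ℝ, E)).tangent 𝓘(ℝ, E).tangent ∞
      (tangentMap (𝓘(ℝ, L).prod 𝓘(ℝ, E)) 𝓘(ℝ, E) (fun z : G × M => z.1 • z.2)) :=
    T.smooth_G.contMDiff_tangentMap (by simp)
  have h2 : ContMDiff 𝓘(ℝ, E) (𝓘(ℝ, L).tangent.prod 𝓘(ℝ, E).tangent) ∞
      (fun m : M => ((⟨1, ξ⟩, ⟨m, 0⟩) : TangentBundle 𝓘(ℝ, L) G × TangentBundle 𝓘(ℝ, E) M)) :=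
    contMDiff_const.prodMk (Bundle.contMDiff_zeroSection ℝ (TangentSpace 𝓘(ℝ, E) (M := M)))
  have h3 := h1.comp (contMDiff_equivTangentBundleProd_symm.comp h2)
  refine h3.congr fun m => ?_
  have h4 : mfderiv (𝓘(ℝ, L).prod 𝓘(ℝ, E)) 𝓘(ℝ, E) (fun z : G × M => z.1 • z.2) (1, m)
      ((ξ, 0) : L × E) = T.kill m ξ + tderiv E E (fun m : M => (1 : G) • m) m 0 :=
    mfderiv_prod_eq_add_apply (v := ((ξ, 0) : L × E))
      (T.smooth_G.mdifferentiable (by simp) ((1 : G), m))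
  rw [map_zero, add_zero] at h4
  have h5 : ∀ {x y : M} {v w : E}, x = y → v = w →
      (⟨x, v⟩ : TangentBundle 𝓘(ℝ, E) M) = ⟨y, w⟩ := by
    rintro x _ v _ rfl rfl; rfl
  exact h5 (one_smul G m).symm h4.symm

omit [FiniteDimensional ℝ L] in
lemma contMDiff_gm {EN : Type*} [NormedAddCommGroup EN] [NormedSpace ℝ EN] {N : Type*}
    [TopologicalSpace N] [ChartedSpace EN N] {u : N → M} {V W : N → E}
    (hV : ContMDiff 𝓘(ℝ, EN) 𝓘(ℝ, E).tangent ∞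
      (fun n => (⟨u n, V n⟩ : TangentBundle 𝓘(ℝ, E) M)))
    (hW : ContMDiff 𝓘(ℝ, EN) 𝓘(ℝ, E).tangent ∞
      (fun n => (⟨u n, W n⟩ : TangentBundle 𝓘(ℝ, E) M))) :
    ContMDiff 𝓘(ℝ, EN) 𝓘(ℝ, ℝ) ∞ (fun n => T.gm (u n) (V n) (W n)) := by
  have hu : ContMDiff 𝓘(ℝ, EN) 𝓘(ℝ, E) ∞ u :=
    (Bundle.contMDiff_proj (TangentSpace 𝓘(ℝ, E) (M := M))).comp hV
  have h : ContMDiff 𝓘(ℝ, EN) (𝓘(ℝ, E).prod 𝓘(ℝ, ℝ)) ∞ (fun n =>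
      Bundle.TotalSpace.mk' ℝ (E := Bundle.Trivial M ℝ) (u n) (T.gm (u n) (V n) (W n))) :=
    ContMDiff.clm_bundle_apply₂ (F₁ := E) (F₂ := E) (T.metric.contMDiff.comp hu) hV hW
  exact fun n => (Bundle.contMDiffAt_totalSpace.1 (h n)).2

/-- The connection form depends smoothly on the vector it is applied to. -/
lemma contMDiff_connForm [LieGroup 𝓘(ℝ, L) ∞ G] {EN : Type*} [NormedAddCommGroup EN]
    [NormedSpace ℝ EN] {N : Type*}
    [TopologicalSpace N] [ChartedSpace EN N] {u : N → M} {V : N → E}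
    (hinj : ∀ n, Function.Injective (T.kill (u n)))
    (hV : ContMDiff 𝓘(ℝ, EN) 𝓘(ℝ, E).tangent ∞
      (fun n => (⟨u n, V n⟩ : TangentBundle 𝓘(ℝ, E) M))) :
    ContMDiff 𝓘(ℝ, EN) 𝓘(ℝ, L) ∞ (fun n => T.connForm (u n) (V n)) := by
  have hu : ContMDiff 𝓘(ℝ, EN) 𝓘(ℝ, E) ∞ u :=
    (Bundle.contMDiff_proj (TangentSpace 𝓘(ℝ, E) (M := M))).comp hV
  have hk (ξ : L) : ContMDiff 𝓘(ℝ, EN) 𝓘(ℝ, E).tangent ∞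
      (fun n => (⟨u n, T.kill (u n) ξ⟩ : TangentBundle 𝓘(ℝ, E) M)) := (T.contMDiff_kill ξ).comp hu
  have hc {W : N → E} (hW : ContMDiff 𝓘(ℝ, EN) 𝓘(ℝ, E).tangent ∞
      (fun n => (⟨u n, W n⟩ : TangentBundle 𝓘(ℝ, E) M))) :
      ContMDiff 𝓘(ℝ, EN) 𝓘(ℝ, L) ∞ (fun n => T.coef (u n) (W n)) := by
    simp only [coef_apply]
    exact contMDiff_finsetSum fun a _ => (T.contMDiff_gm hW (hk _)).smul contMDiff_const
  have hg : ContMDiff 𝓘(ℝ, EN) 𝓘(ℝ, L →L[ℝ] L) ∞ (fun n => T.coef (u n) ∘L T.kill (u n)) := by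
    have he (n : N) : T.coef (u n) ∘L T.kill (u n)
        = ∑ c, ContinuousLinearMap.smulRightL ℝ L L
            ((Module.finBasis ℝ L).coord c).toContinuousLinearMap
            (T.coef (u n) (T.kill (u n) (Module.finBasis ℝ L c))) := by
      apply ContinuousLinearMap.coe_injective
      refine (Module.finBasis ℝ L).ext fun a => ?_
      simp [Finsupp.single_apply]
    simp only [he]
    exact contMDiff_finsetSum fun c _ =>
      (ContinuousLinearMap.contDiff _).contMDiff.comp (hc (hk _))
  have : CompleteSpace L := FiniteDimensional.complete ℝ L
  have hi : ContMDiff 𝓘(ℝ, EN) 𝓘(ℝ, L →L[ℝ] L) ∞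
      (fun n => Ring.inverse (T.coef (u n) ∘L T.kill (u n))) := fun n => by
    obtain ⟨x, hx⟩ := isUnit_gram (hinj n)
    have h := contDiffAt_ringInverse ℝ (n := ∞) x
    rw [hx] at h
    exact h.contMDiffAt.comp n (hg n)
  exact hi.clm_apply (hc hV)

end Connection

end TargetData

/-! ### Immersions -/

section Immersion

variable {E E' : Type*} [NormedAddCommGroup E] [NormedSpace ℝ E]
  [NormedAddCommGroup E'] [NormedSpace ℝ E']
  {M N : Type*} [TopologicalSpace M] [ChartedSpace E M] [TopologicalSpace N] [ChartedSpace E' N]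

/-- The differential of an immersion is injective, since an immersion has a local left inverse. -/
lemma tderiv_injective_of_isImmersionAt {f : M → N} {x : M}
    (h : Manifold.IsImmersionAt 𝓘(ℝ, E) 𝓘(ℝ, E') ∞ f x) :
    Function.Injective (tderiv E E' f x) := by
  let r : N → M := fun y => h.domChart.symm (h.equiv.symm (h.codChart y)).1
  have hdx : h.domChart x ∈ h.domChart.target := h.domChart.map_source h.mem_domChart_source
  have hfx : (h.equiv.symm (h.codChart (f x))).1 = h.domChart x ∧
      ∀ y ∈ h.domChart.source, (h.equiv.symm (h.codChart (f y))).1 = h.domChart y := by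
    have hy : ∀ y ∈ h.domChart.source, (h.equiv.symm (h.codChart (f y))).1 = h.domChart y := by
      intro y hy
      have hm : h.domChart.extend 𝓘(ℝ, E) y ∈ (h.domChart.extend 𝓘(ℝ, E)).target :=
        (h.domChart.extend 𝓘(ℝ, E)).map_source (by rw [h.domChart.extend_source]; exact hy)
      have hl : (h.domChart.extend 𝓘(ℝ, E)).symm (h.domChart.extend 𝓘(ℝ, E) y) = y :=
        h.domChart.extend_left_inv hy
      have hw := h.writtenInCharts hm
      rw [Function.comp_apply, Function.comp_apply, hl] at hw
      have hw' : h.codChart (f y) = h.equiv (h.domChart y, 0) := hw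
      rw [hw', ContinuousLinearEquiv.symm_apply_apply]
    exact ⟨hy x h.mem_domChart_source, hy⟩
  have hr : ContMDiffAt 𝓘(ℝ, E') 𝓘(ℝ, E) ∞ r (f x) := by
    have h1 : ContMDiffAt 𝓘(ℝ, E') 𝓘(ℝ, E') ∞ h.codChart (f x) :=
      contMDiffAt_of_mem_maximalAtlas h.codChart_mem_maximalAtlas h.mem_codChart_source
    have h2 : ContMDiffAt 𝓘(ℝ, E') 𝓘(ℝ, E) ∞
        (fun y => (h.equiv.symm (h.codChart y)).1) (f x) := by
      have h3 : ContDiff ℝ ∞ (fun e => (h.equiv.symm e).1) :=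
        contDiff_fst.comp h.equiv.symm.contDiff
      exact h3.contMDiff.contMDiffAt.comp _ h1
    have h4 : ContMDiffAt 𝓘(ℝ, E) 𝓘(ℝ, E) ∞ h.domChart.symm
        ((fun y => (h.equiv.symm (h.codChart y)).1) (f x)) := by
      simp only [hfx.1]
      exact contMDiffAt_symm_of_mem_maximalAtlas h.domChart_mem_maximalAtlas hdx
    exact ContMDiffAt.comp (g := h.domChart.symm)
      (f := fun y => (h.equiv.symm (h.codChart y)).1) (f x) h4 h2
  have hrf : (fun y => r (f y)) =ᶠ[𝓝 x] fun y => y := by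
    filter_upwards [h.domChart.open_source.mem_nhds h.mem_domChart_source] with y hy
    simp only [r, hfx.2 y hy, h.domChart.left_inv hy]
  refine Function.LeftInverse.injective (g := tderiv E' E r (f x)) fun v => ?_
  rw [← tderiv_comp (hr.mdifferentiableAt (by simp)) (h.contMDiffAt.mdifferentiableAt (by simp)),
    tderiv_congr hrf, tderiv_id]
  rfl

end Immersion

namespace TargetData

variable {E : Type*} [NormedAddCommGroup E] [NormedSpace ℝ E]
  {M : Type*} [TopologicalSpace M] [ChartedSpace E M] [IsManifold 𝓘(ℝ, E) ∞ M]
  {L : Type*} [NormedAddCommGroup L] [NormedSpace ℝ L]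
  {G : Type*} [Group G] [TopologicalSpace G] [ChartedSpace L G]
  [MulDistribMulAction Sp1 G] [MulAction G M] [MulAction Sp1 M]
  {T : TargetData E M L G}
  {EZ : Type*} [NormedAddCommGroup EZ] [NormedSpace ℝ EZ] [ChartedSpace EZ T.Level]
  {E₀ : Type*} [NormedAddCommGroup E₀] [NormedSpace ℝ E₀] [ChartedSpace E₀ T.Reduction]

variable (T) in
/-- The complex structures of the reduction, as endomorphisms of the model space. -/
noncomputable def reducedCplx (EZ : Type*) [NormedAddCommGroup EZ] [NormedSpace ℝ EZ]
    [ChartedSpace EZ T.Level] (E₀ : Type*) [NormedAddCommGroup E₀] [NormedSpace ℝ E₀]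
    [ChartedSpace E₀ T.Reduction] (j : Fin 3) (y : T.Reduction) : E₀ →L[ℝ] E₀ :=
  T.reducedI EZ E₀ j y

/-! ### The level set and its projection to the reduction -/

section Level

lemma toReduction_eq_iff {z z' : T.Level} :
    T.toReduction z = T.toReduction z' ↔ ∃ g : G, g • z' = z :=
  Quotient.eq.trans Iff.rfl

lemma toReduction_surjective : Function.Surjective T.toReduction := Quotient.mk_surjective

section Embedded

variable (hsub : Manifold.IsSmoothEmbedding 𝓘(ℝ, EZ) 𝓘(ℝ, E) ∞ (Subtype.val : T.Level → M))
include hsub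

/-- A map to the level set is smooth if it is smooth as a map to `M`. -/
lemma contMDiff_level {EN : Type*} [NormedAddCommGroup EN] [NormedSpace ℝ EN] {HN : Type*}
    [TopologicalSpace HN] {IN : ModelWithCorners ℝ EN HN} {N : Type*}
    [TopologicalSpace N] [ChartedSpace HN N] [IsManifold IN ∞ N]
    [IsManifold 𝓘(ℝ, EZ) ∞ T.Level] {u : N → T.Level}
    (hu : ContMDiff IN 𝓘(ℝ, E) ∞ (fun n => (u n).1)) : ContMDiff IN 𝓘(ℝ, EZ) ∞ u :=
  (ContMDiff.iff_comp_isImmersion hsub.isImmersion).2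
    ⟨hsub.isEmbedding.continuous_iff.2 hu.continuous, hu⟩

lemma mdifferentiable_val :
    MDifferentiable 𝓘(ℝ, EZ) 𝓘(ℝ, E) (Subtype.val : T.Level → M) :=
  hsub.contMDiff.mdifferentiable (by simp)

lemma tan_tderiv_val (z : T.Level) (w : EZ) :
    T.Tan z.1 (tderiv EZ E (Subtype.val : T.Level → M) z w) := by
  intro i
  have h := tderiv_comp (E := EZ) (E' := E) (E'' := L) (g := T.μ i)
    (f := (Subtype.val : T.Level → M)) (x := z)
    ((T.μ_smooth i).mdifferentiable (by simp) _) (mdifferentiable_val hsub z) w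
  have h0 : (fun z : T.Level => T.μ i z.1) = fun _ => 0 := by
    funext z; exact z.2 i
  rw [h0, tderiv_const] at h
  exact h.symm

lemma tderiv_val_injective [IsManifold 𝓘(ℝ, EZ) ∞ T.Level] (z : T.Level) :
    Function.Injective (tderiv EZ E (Subtype.val : T.Level → M) z) :=
  tderiv_injective_of_isImmersionAt (hsub.isImmersion.isImmersionAt z)

lemma Tan.exists_tderiv_val [IsManifold 𝓘(ℝ, EZ) ∞ T.Level] [FiniteDimensional ℝ E]
    [FiniteDimensional ℝ L] (hreg : T.ZeroIsRegular) (z : T.Level) {v : E} (hv : T.Tan z.1 v) :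
    ∃ w : EZ, tderiv EZ E (Subtype.val : T.Level → M) z w = v := by
  have hμ : ContMDiff 𝓘(ℝ, E) 𝓘(ℝ, Fin 3 → L) ∞ (fun m i => T.μ i m) :=
    contMDiff_pi_space.2 T.μ_smooth
  have hd (w : E) : tderiv E (Fin 3 → L) (fun m i => T.μ i m) z.1 w
      = fun i => tderiv E L (T.μ i) z.1 w := by
    funext i
    have h := tderiv_comp (E := E) (E' := Fin 3 → L) (E'' := L) (g := fun c : Fin 3 → L => c i)
      (f := fun m i => T.μ i m) (x := z.1)
      (ContinuousLinearMap.proj (R := ℝ) (φ := fun _ : Fin 3 => L) i).mdifferentiableAt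
      (hμ.mdifferentiable (by simp) _) w
    rw [h]
    have h' : tderiv (Fin 3 → L) L (fun c : Fin 3 → L => c i) (fun i => T.μ i z.1)
        = ContinuousLinearMap.proj (R := ℝ) (φ := fun _ : Fin 3 => L) i :=
      (ContinuousLinearMap.proj (R := ℝ) (φ := fun _ : Fin 3 => L) i).hasMFDerivAt.mfderiv
    rw [h']
    rfl
  refine exists_tderiv_val_eq hsub hμ z (fun m hm i => ?_) (fun c => ?_) ?_
  · exact (congrFun hm i).trans (z.2 i)
  · obtain ⟨w, hw⟩ := hreg z.1 z.2 c
    exact ⟨w, (hd w).trans hw⟩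
  · rw [hd]; funext i; exact hv i

end Embedded

section Quotient

variable (hquot : IsPrincipalBundle 𝓘(ℝ, E₀) 𝓘(ℝ, EZ) 𝓘(ℝ, L) (fun (h : G) (z : T.Level) => h • z)
  T.toReduction)
include hquot

lemma mdifferentiable_toReduction :
    MDifferentiable 𝓘(ℝ, EZ) 𝓘(ℝ, E₀) T.toReduction :=
  hquot.smooth_proj.mdifferentiable (by simp)

lemma mdifferentiable_level_smul_right (z : T.Level) :
    MDifferentiable 𝓘(ℝ, L) 𝓘(ℝ, EZ) (fun g : G => g • z) :=
  (hquot.smooth_act.comp (contMDiff_id.prodMk contMDiff_const) :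
    ContMDiff 𝓘(ℝ, L) 𝓘(ℝ, EZ) ∞ (fun g : G => g • z)).mdifferentiable (by simp)

lemma mdifferentiable_level_smul_left (g : G) :
    MDifferentiable 𝓘(ℝ, EZ) 𝓘(ℝ, EZ) (fun z : T.Level => g • z) :=
  (hquot.smooth_act.comp (contMDiff_const.prodMk contMDiff_id) :
    ContMDiff 𝓘(ℝ, EZ) 𝓘(ℝ, EZ) ∞ (fun z : T.Level => g • z)).mdifferentiable (by simp)

lemma tderiv_toReduction_surjective (z : T.Level) :
    Function.Surjective (tderiv EZ E₀ T.toReduction z) := by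
  intro y
  obtain ⟨U, hU, hzU, s, τ, hs, hτ, hsτ, hτs⟩ := hquot.locally_trivial (T.toReduction z)
  have hsz : τ z • s (T.toReduction z) = z := hτs z hzU
  have hsd : MDifferentiableAt 𝓘(ℝ, E₀) 𝓘(ℝ, EZ) s (T.toReduction z) :=
    ((hs _ hzU).contMDiffAt (hU.mem_nhds hzU)).mdifferentiableAt (by simp)
  have hgs : MDifferentiableAt 𝓘(ℝ, E₀) 𝓘(ℝ, EZ) (fun x => τ z • s x) (T.toReduction z) :=
    (mdifferentiable_level_smul_left hquot (τ z) _).comp _ hsd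
  refine ⟨tderiv E₀ EZ (fun x => τ z • s x) (T.toReduction z) y, ?_⟩
  have h := tderiv_comp (E := E₀) (E' := EZ) (E'' := E₀) (g := T.toReduction)
    (f := fun x => τ z • s x) (x := T.toReduction z)
    (mdifferentiable_toReduction hquot _) hgs y
  simp only [hsz] at h
  rw [← h]
  have he : (fun x => T.toReduction (τ z • s x)) =ᶠ[𝓝 (T.toReduction z)] fun x => x := by
    filter_upwards [hU.mem_nhds hzU] with x hx
    exact (hquot.proj_act _ _).trans (hsτ x hx).1
  rw [tderiv_congr he, tderiv_id]
  rfl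

lemma tderiv_toReduction_killing (z : T.Level) (ξ : L) :
    tderiv EZ E₀ T.toReduction z (tderiv L EZ (fun g : G => g • z) 1 ξ) = 0 := by
  have h := tderiv_comp (E := L) (E' := EZ) (E'' := E₀) (g := T.toReduction)
    (f := fun g : G => g • z) (x := 1)
    (mdifferentiable_toReduction hquot _) (mdifferentiable_level_smul_right hquot z _) ξ
  have h0 : (fun g : G => T.toReduction (g • z)) = fun _ => T.toReduction z := by
    funext g; exact hquot.proj_act g z
  rw [h0, tderiv_const, one_smul] at h
  exact h.symm

/-- The vertical vectors of `μ⁻¹(0) → M₀` are the Killing vectors. -/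
lemma exists_killing_of_tderiv_toReduction_eq_zero [LieGroup 𝓘(ℝ, L) ∞ G] (z : T.Level) {w : EZ}
    (hw : tderiv EZ E₀ T.toReduction z w = 0) :
    ∃ ξ : L, tderiv L EZ (fun g : G => g • z) 1 ξ = w := by
  obtain ⟨U, hU, hzU, s, τ, hs, hτ, hsτ, hτs⟩ := hquot.locally_trivial (T.toReduction z)
  have hsz : τ z • s (T.toReduction z) = z := hτs z hzU
  have hπ : ContMDiff 𝓘(ℝ, EZ) 𝓘(ℝ, E₀) ∞ T.toReduction := hquot.smooth_proj
  have hVo : IsOpen (T.toReduction ⁻¹' U) := hU.preimage hπ.continuous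
  have hsd : MDifferentiableAt 𝓘(ℝ, E₀) 𝓘(ℝ, EZ) s (T.toReduction z) :=
    ((hs _ hzU).contMDiffAt (hU.mem_nhds hzU)).mdifferentiableAt (by simp)
  have hsπ : MDifferentiableAt 𝓘(ℝ, EZ) 𝓘(ℝ, EZ) (fun y => s (T.toReduction y)) z :=
    hsd.comp z (mdifferentiable_toReduction hquot z)
  have hτd : MDifferentiableAt 𝓘(ℝ, EZ) 𝓘(ℝ, L) τ z :=
    ((hτ _ hzU).contMDiffAt (hVo.mem_nhds hzU)).mdifferentiableAt (by simp)
  have h := tderiv_comp₂ (E := EZ) (E' := L) (E'' := EZ) (E₃ := EZ) (F := fun (g : G) z => g • z)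
    (a := τ) (b := fun y => s (T.toReduction y)) (x := z)
    (hquot.smooth_act.mdifferentiable (by simp) _) hτd hsπ w
  have he : (fun y => τ y • s (T.toReduction y)) =ᶠ[𝓝 z] fun y => y := by
    filter_upwards [hVo.mem_nhds hzU] with y hy
    exact hτs y hy
  rw [tderiv_congr he, tderiv_id,
    tderiv_comp (E' := E₀) hsd (mdifferentiable_toReduction hquot z), hw, map_zero, map_zero,
    add_zero] at h
  -- `k ↦ k • s` is the orbit map of `z = τ • s` after the right translation by `τ⁻¹`
  have h1 := tderiv_comp (E := L) (E' := L) (E'' := EZ) (g := fun g : G => g • z)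
    (f := fun k : G => k * (τ z)⁻¹) (x := τ z) (mdifferentiable_level_smul_right hquot z _)
    ((contMDiff_id.mul contMDiff_const : ContMDiff 𝓘(ℝ, L) 𝓘(ℝ, L) ∞
      (fun k : G => k * (τ z)⁻¹)).mdifferentiable (by simp) _) (tderiv EZ L τ z w)
  have h2 : (fun k : G => (k * (τ z)⁻¹) • z) = fun k : G => k • s (T.toReduction z) := by
    funext k
    nth_rw 2 [← hsz]
    rw [smul_smul, inv_mul_cancel_right]
  rw [h2, mul_inv_cancel] at h1
  exact ⟨_, h1.symm.trans h.symm⟩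

end Quotient

end Level

/-! ### The complex structures of the reduction -/

section Reduction

variable (hsub : Manifold.IsSmoothEmbedding 𝓘(ℝ, EZ) 𝓘(ℝ, E) ∞ (Subtype.val : T.Level → M))
  (hquot : IsPrincipalBundle 𝓘(ℝ, E₀) 𝓘(ℝ, EZ) 𝓘(ℝ, L) (fun (h : G) (z : T.Level) => h • z)
    T.toReduction)
include hsub hquot

lemma tderiv_val_killing (z : T.Level) (ξ : L) :
    tderiv EZ E (Subtype.val : T.Level → M) z (tderiv L EZ (fun g : G => g • z) 1 ξ)
      = T.kill z.1 ξ := by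
  have h := tderiv_comp (E := L) (E' := EZ) (E'' := E) (g := (Subtype.val : T.Level → M))
    (f := fun g : G => g • z) (x := 1)
    (mdifferentiable_val hsub _) (mdifferentiable_level_smul_right hquot z _) ξ
  rw [one_smul] at h
  exact h.symm

lemma tderiv_val_smul (g : G) (z : T.Level) (w : EZ) :
    tderiv EZ E (Subtype.val : T.Level → M) (g • z) (tderiv EZ EZ (fun z : T.Level => g • z) z w)
      = tderiv E E (fun m : M => g • m) z.1 (tderiv EZ E (Subtype.val : T.Level → M) z w) := by
  have h1 := tderiv_comp (E := EZ) (E' := EZ) (E'' := E) (g := (Subtype.val : T.Level → M))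
    (f := fun z : T.Level => g • z) (x := z)
    (mdifferentiable_val hsub _) (mdifferentiable_level_smul_left hquot g _) w
  have h2 := tderiv_comp (E := EZ) (E' := E) (E'' := E) (g := fun m : M => g • m)
    (f := (Subtype.val : T.Level → M)) (x := z)
    ((T.contMDiff_smul_left g).mdifferentiable (by simp) _) (mdifferentiable_val hsub z) w
  exact h1.symm.trans h2

omit hsub in
lemma tderiv_toReduction_smul (g : G) (z : T.Level) (w : EZ) :
    tderiv EZ E₀ T.toReduction (g • z) (tderiv EZ EZ (fun z : T.Level => g • z) z w)
      = tderiv EZ E₀ T.toReduction z w := by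
  have h := tderiv_comp (E := EZ) (E' := EZ) (E'' := E₀) (g := T.toReduction)
    (f := fun z : T.Level => g • z) (x := z)
    (mdifferentiable_toReduction hquot _) (mdifferentiable_level_smul_left hquot g _) w
  rw [← h]
  congr 2
  funext y
  exact hquot.proj_act g y

variable [LieGroup 𝓘(ℝ, L) ∞ G]

/-- The projection to the reduction is injective on horizontal vectors. -/
lemma eq_zero_of_hor_of_tderiv_toReduction_eq_zero {z : T.Level} {w : EZ}
    (hw : T.Hor z.1 (tderiv EZ E (Subtype.val : T.Level → M) z w))
    (h0 : tderiv EZ E₀ T.toReduction z w = 0) :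
    tderiv EZ E (Subtype.val : T.Level → M) z w = 0 := by
  obtain ⟨ξ, rfl⟩ := exists_killing_of_tderiv_toReduction_eq_zero hquot z h0
  rw [tderiv_val_killing hsub hquot] at hw ⊢
  exact hw.eq_zero_of_eq_kill

variable [IsManifold 𝓘(ℝ, EZ) ∞ T.Level] [FiniteDimensional ℝ L]
  [FiniteDimensional ℝ E₀] (hreg : T.ZeroIsRegular)
include hreg

/-- The complex structure at one point of the reduction, described by means of one point `z` of the
fibre. -/
lemma exists_inducedI_at (j : Fin 3) (z : T.Level) :
    ∃ A : E₀ →L[ℝ] E₀, ∀ h h' : EZ,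
      T.Hor z.1 (tderiv EZ E (Subtype.val : T.Level → M) z h) →
      tderiv EZ E (Subtype.val : T.Level → M) z h'
        = T.cplx j z.1 (tderiv EZ E (Subtype.val : T.Level → M) z h) →
      A (tderiv EZ E₀ T.toReduction z h) = tderiv EZ E₀ T.toReduction z h' := by
  have hinj := T.kill_injective hreg z.2
  set ι : EZ →L[ℝ] E := tderiv EZ E (Subtype.val : T.Level → M) z with hι
  set dπ : EZ →L[ℝ] E₀ := tderiv EZ E₀ T.toReduction z with hdπ
  set κ : L →L[ℝ] EZ := tderiv L EZ (fun g : G => g • z) 1 with hκ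
  obtain ⟨σ, hσ⟩ := dπ.toLinearMap.exists_rightInverse_of_surjective
    (LinearMap.range_eq_top.2 (tderiv_toReduction_surjective hquot z))
  obtain ⟨ρ, hρ⟩ := ι.toLinearMap.exists_leftInverse_of_injective
    (LinearMap.ker_eq_bot.2 (tderiv_val_injective hsub z))
  have hρ' (w : EZ) : ρ (ι w) = w := LinearMap.congr_fun hρ w
  -- the orthogonal projection of `T_z μ⁻¹(0)` to the horizontal vectors
  let p : EZ →ₗ[ℝ] EZ := LinearMap.id - (κ ∘L T.connForm z.1 ∘L ι).toLinearMap
  have hικ (ξ : L) : ι (κ ξ) = T.kill z.1 ξ := tderiv_val_killing hsub hquot z ξ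
  have hdp (w : EZ) : dπ (p w) = dπ w := by
    have : dπ (κ (T.connForm z.1 (ι w))) = 0 := tderiv_toReduction_killing hquot z _
    simp [p, this]
  have hph (w : EZ) : T.Hor z.1 (ι (p w)) := by
    have : ι (p w) = ι w - T.kill z.1 (T.connForm z.1 (ι w)) := by simp [p, hικ]
    rw [this]
    exact hor_sub_kill_connForm hinj _
  let A : E₀ →ₗ[ℝ] E₀ :=
    dπ.toLinearMap ∘ₗ ρ ∘ₗ (T.cplx j z.1).toLinearMap ∘ₗ ι.toLinearMap ∘ₗ p ∘ₗ σ
  refine ⟨LinearMap.toContinuousLinearMap A, fun h h' hh hh' => ?_⟩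
  have hσ' : dπ (p (σ (dπ h)) - h) = 0 := by
    rw [map_sub, hdp, sub_eq_zero]
    exact LinearMap.congr_fun hσ (dπ h)
  have hz : ι (p (σ (dπ h)) - h) = 0 :=
    eq_zero_of_hor_of_tderiv_toReduction_eq_zero hsub hquot (z := z)
      (by rw [← hι, map_sub]; exact (hph _).sub hh) hσ'
  rw [map_sub, sub_eq_zero] at hz
  change dπ (ρ (T.cplx j z.1 (ι (p (σ (dπ h)))))) = dπ h'
  rw [hz, ← hh', hρ']

/-- The induced complex structures exist: the description by means of a point of the fibre does not
depend on the point, since `G` acts by holomorphic isometries. -/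
lemma exists_isInducedI (j : Fin 3) : ∃ A, T.IsInducedI (E₀ := E₀) EZ j A := by
  have hex (y : T.Reduction) : ∃ A : E₀ →L[ℝ] E₀, ∀ z : T.Level, T.toReduction z = y →
      ∀ h h' : EZ, T.Hor z.1 (tderiv EZ E (Subtype.val : T.Level → M) z h) →
      tderiv EZ E (Subtype.val : T.Level → M) z h'
        = T.cplx j z.1 (tderiv EZ E (Subtype.val : T.Level → M) z h) →
      A (tderiv EZ E₀ T.toReduction z h) = tderiv EZ E₀ T.toReduction z h' := by
    obtain ⟨z₀, rfl⟩ := toReduction_surjective y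
    obtain ⟨A, hA⟩ := exists_inducedI_at hsub hquot hreg j z₀
    refine ⟨A, fun z hz h h' hh hh' => ?_⟩
    obtain ⟨g, rfl⟩ := toReduction_eq_iff.1 hz.symm
    rw [← tderiv_toReduction_smul hquot g z h, ← tderiv_toReduction_smul hquot g z h']
    refine hA _ _ ?_ ?_
    · rw [tderiv_val_smul hsub hquot]
      exact hh.smul g
    · rw [tderiv_val_smul hsub hquot, tderiv_val_smul hsub hquot, hh', tderiv_smul_cplx]
      rfl
  choose A hA using hex
  exact ⟨A, fun z h h' hh hh' => hA _ z rfl h h' hh hh'⟩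

/-- As the induced structures exist, `reducedCplx` does not take its default value `0`. -/
lemma reducedCplx_tderiv_toReduction (j : Fin 3) (z : T.Level) {h h' : EZ}
    (hh : T.Hor z.1 (tderiv EZ E (Subtype.val : T.Level → M) z h))
    (hh' : tderiv EZ E (Subtype.val : T.Level → M) z h'
      = T.cplx j z.1 (tderiv EZ E (Subtype.val : T.Level → M) z h)) :
    T.reducedCplx EZ E₀ j (T.toReduction z) (tderiv EZ E₀ T.toReduction z h)
      = tderiv EZ E₀ T.toReduction z h' := by
  have hex := exists_isInducedI (E₀ := E₀) hsub hquot hreg j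
  have hr : T.reducedI EZ E₀ j = hex.choose := dif_pos hex
  rw [reducedCplx, hr]
  exact hex.choose_spec z h h' hh hh'

end Reduction

end TargetData

/-! ### The Dirac equation and its projection to the reduction -/

section Spinors

variable {X : Type*} [TopologicalSpace X] [ChartedSpace (EuclideanSpace ℝ (Fin 4)) X]
  [IsManifold (𝓡 4) ∞ X] {g : SmoothMetric (EuclideanSpace ℝ (Fin 4)) X}
  {o : ∀ x : X, Orientation ℝ (TangentSpace (𝓡 4) x) (Fin 4)}
  {EQ : Type*} [NormedAddCommGroup EQ] [NormedSpace ℝ EQ]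
  {Q : Type*} [TopologicalSpace Q] [ChartedSpace EQ Q] [IsManifold 𝓘(ℝ, EQ) ∞ Q]
  [MulAction Spin4ᵐᵒᵖ Q]

/-- The complex structure `J_j` in the frame `f`, as an endomorphism of the model space. -/
noncomputable def SpinStructure.cplx (S : SpinStructure g o EQ Q) (j : Fin 3) (f : Q) :
    EuclideanSpace ℝ (Fin 4) →L[ℝ] EuclideanSpace ℝ (Fin 4) := S.J j f

/-- The horizontal lift to `f`, as a map between the model spaces. -/
noncomputable def LeviCivita.hlift {S : SpinStructure g o EQ Q} (C : LeviCivita S) (f : Q) :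
    EuclideanSpace ℝ (Fin 4) →L[ℝ] EQ := C.lift f

/-- The projection of tangent vectors of `Q` to `X`, as a map between the model spaces. -/
noncomputable def SpinStructure.dproj (S : SpinStructure g o EQ Q) (f : Q) :
    EQ →L[ℝ] EuclideanSpace ℝ (Fin 4) := tderiv EQ (EuclideanSpace ℝ (Fin 4)) S.proj f

lemma SpinStructure.dproj_hlift {S : SpinStructure g o EQ Q} (C : LeviCivita S) (f : Q)
    (v : EuclideanSpace ℝ (Fin 4)) : S.dproj f (C.hlift f v) = v := C.proj_lift f v

lemma linearPart_eq_zero_iff (S : SpinStructure g o EQ Q)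
    {EN : Type*} [NormedAddCommGroup EN] [NormedSpace ℝ EN]
    {N : Type*} [TopologicalSpace N] [ChartedSpace EN N] (n : N) (I : Fin 3 → EN →L[ℝ] EN) (f : Q)
    (A : EuclideanSpace ℝ (Fin 4) →L[ℝ] EN) :
    linearPart (N := N) (n := n) S I f A = 0 ↔ ∀ v, A v = ∑ j, I j (A (S.cplx j f v)) := by
  have h : linearPart (N := N) (n := n) S I f A
    = (1 / 4 : ℝ) • (A - ∑ j, I j ∘L A ∘L S.cplx j f) := rfl
  have h0 : (0 : EuclideanSpace ℝ (Fin 4) →L[ℝ] EN) = (1 / 4 : ℝ) • 0 := (smul_zero _).symm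
  have h1 : (linearPart (N := N) (n := n) S I f A = 0) ↔
      ((1 / 4 : ℝ) • (A - ∑ j, I j ∘L A ∘L S.cplx j f) = 0) := by rw [h]; exact Iff.rfl
  rw [h1, smul_eq_zero_iff_right (by norm_num), sub_eq_zero, ContinuousLinearMap.ext_iff]
  simp

variable {E : Type*} [NormedAddCommGroup E] [NormedSpace ℝ E]
  {M : Type*} [TopologicalSpace M] [ChartedSpace E M] [IsManifold 𝓘(ℝ, E) ∞ M]
  {L : Type*} [NormedAddCommGroup L] [NormedSpace ℝ L]
  {G : Type*} [Group G] [TopologicalSpace G] [ChartedSpace L G]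
  [MulDistribMulAction Sp1 G] [MulAction G M] [MulAction Sp1 M]
  {T : TargetData E M L G}
  {EZ : Type*} [NormedAddCommGroup EZ] [NormedSpace ℝ EZ] [ChartedSpace EZ T.Level]
  {E₀ : Type*} [NormedAddCommGroup E₀] [NormedSpace ℝ E₀] [ChartedSpace E₀ T.Reduction]

/-- If the `ℍ`-linear part of a covariant derivative with values in the kernel of the differential
of the momentum map vanishes, then the covariant derivative is orthogonal to the orbit. -/
lemma TargetData.hor_of_tan_of_linearPart {m : M} {V : Type*} {A : V → E} {J : Fin 3 → V → V}
    (ht : ∀ v, T.Tan m (A v)) (hA : ∀ v, A v = ∑ j, T.cplx j m (A (J j v))) (v : V) :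
    T.Hor m (A v) := by
  rw [hA, Fin.sum_univ_three]
  exact (((ht _).hor_cplx 0).add ((ht _).hor_cplx 1)).add ((ht _).hor_cplx 2)

section Descent

variable (hsub : Manifold.IsSmoothEmbedding 𝓘(ℝ, EZ) 𝓘(ℝ, E) ∞ (Subtype.val : T.Level → M))
  (hquot : IsPrincipalBundle 𝓘(ℝ, E₀) 𝓘(ℝ, EZ) 𝓘(ℝ, L) (fun (h : G) (z : T.Level) => h • z)
    T.toReduction) [LieGroup 𝓘(ℝ, L) ∞ G]
  [IsManifold 𝓘(ℝ, EZ) ∞ T.Level] [FiniteDimensional ℝ E] [FiniteDimensional ℝ L]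
  [FiniteDimensional ℝ E₀] (hreg : T.ZeroIsRegular)
include hsub hquot hreg

/-- For a horizontal linear map, the vanishing of the `ℍ`-linear part can be tested after projection
to the reduction. -/
lemma TargetData.linearPart_iff_toReduction (z : T.Level) {V : Type*} {A : V → EZ}
    {J : Fin 3 → V → V}
    (hA : ∀ v, T.Hor z.1 (tderiv EZ E (Subtype.val : T.Level → M) z (A v))) (v : V) :
    (tderiv EZ E (Subtype.val : T.Level → M) z (A v)
      = ∑ j, T.cplx j z.1 (tderiv EZ E (Subtype.val : T.Level → M) z (A (J j v)))) ↔
    tderiv EZ E₀ T.toReduction z (A v)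
      = ∑ j, T.reducedCplx EZ E₀ j (T.toReduction z)
          (tderiv EZ E₀ T.toReduction z (A (J j v))) := by
  have ht (v : V) := TargetData.tan_tderiv_val hsub z (A v)
  choose h hh using fun j => ((ht (J j v)).cplx (hA (J j v)) j).exists_tderiv_val hsub hreg z
  have hr (j : Fin 3) := TargetData.reducedCplx_tderiv_toReduction (E₀ := E₀) hsub hquot hreg j z
    (hA (J j v)) (hh j)
  simp only [hr, ← hh, ← map_sum]
  refine ⟨fun he => by rw [TargetData.tderiv_val_injective hsub z he], fun he => ?_⟩
  rw [← sub_eq_zero, ← map_sub]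
  refine TargetData.eq_zero_of_hor_of_tderiv_toReduction_eq_zero hsub hquot ?_ ?_
  · rw [map_sub, map_sum]
    refine (hA v).sub ?_
    simp only [hh, Fin.sum_univ_three]
    exact (((ht _).hor_cplx 0).add ((ht _).hor_cplx 1)).add ((ht _).hor_cplx 2)
  · rw [map_sub, he, sub_self]

/-- The Dirac equation for `(u, b)` means that the covariant derivative of `u` is horizontal and
that the projection of `u` to the reduction is a pure harmonic spinor. -/
lemma dirac_eq_zero_iff {S : SpinStructure g o EQ Q} (C : LeviCivita S)
    (u : Spinor EQ Q E M) (b : LieForm S L G) {uZ : Q → T.Level}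
    (hu : ∀ f, (uZ f).1 = u.toFun f) (v : Spinor EQ Q E₀ T.Reduction)
    (hv : ∀ f, v.toFun f = T.toReduction (uZ f)) (f : Q) :
    dirac C T u b f = 0 ↔
      (∀ x : EuclideanSpace ℝ (Fin 4), T.Hor (u.toFun f) (tderiv EQ E u.toFun f (C.hlift f x)
        + T.kill (u.toFun f) (b.toFun f (C.hlift f x)))) ∧ pureDirac C T EZ v f = 0 := by
  obtain ⟨u, hus, hue⟩ := u
  obtain ⟨v, hvs, hve⟩ := v
  obtain rfl : (fun f => (uZ f).1) = u := funext hu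
  obtain rfl : v = fun f => T.toReduction (uZ f) := funext hv
  have huZ : MDifferentiableAt 𝓘(ℝ, EQ) 𝓘(ℝ, EZ) uZ f :=
    (TargetData.contMDiff_level hsub hus).mdifferentiable (by simp) f
  let β : EuclideanSpace ℝ (Fin 4) → L := fun x => b.toFun f (C.hlift f x)
  let A : EuclideanSpace ℝ (Fin 4) → EZ := fun x =>
    tderiv EQ EZ uZ f (C.hlift f x) + tderiv L EZ (fun h : G => h • uZ f) 1 (β x)
  have hA (x : EuclideanSpace ℝ (Fin 4)) : tderiv EZ E (Subtype.val : T.Level → M) (uZ f) (A x)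
      = tderiv EQ E (fun f => (uZ f).1) f (C.hlift f x) + T.kill (uZ f).1 (β x) := by
    rw [map_add, TargetData.tderiv_val_killing hsub hquot,
      tderiv_comp (TargetData.mdifferentiable_val hsub _) huZ]
  have hA₀ (x : EuclideanSpace ℝ (Fin 4)) : tderiv EZ E₀ T.toReduction (uZ f) (A x)
      = tderiv EQ E₀ (fun f => T.toReduction (uZ f)) f (C.hlift f x) := by
    rw [map_add, TargetData.tderiv_toReduction_killing hquot, add_zero,
      tderiv_comp (TargetData.mdifferentiable_toReduction hquot _) huZ]
  have h1 := linearPart_eq_zero_iff S (uZ f).1 (fun j => T.cplx j (uZ f).1) f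
    (tderiv EQ E (fun f => (uZ f).1) f ∘L C.hlift f + T.kill (uZ f).1 ∘L b.toFun f ∘L C.hlift f)
  have h2 := linearPart_eq_zero_iff S (T.toReduction (uZ f))
    (fun j => T.reducedCplx EZ E₀ j (T.toReduction (uZ f))) f
    (tderiv EQ E₀ (fun f => T.toReduction (uZ f)) f ∘L C.hlift f)
  have h1' : dirac C T ⟨fun f => (uZ f).1, hus, hue⟩ b f = 0 ↔
      ∀ x, tderiv EZ E (Subtype.val : T.Level → M) (uZ f) (A x) = ∑ j, T.cplx j (uZ f).1
        (tderiv EZ E (Subtype.val : T.Level → M) (uZ f) (A (S.cplx j f x))) := by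
    simp only [hA]
    exact h1
  have h2' : pureDirac C T EZ ⟨fun f => T.toReduction (uZ f), hvs, hve⟩ f = 0 ↔
      ∀ x, tderiv EZ E₀ T.toReduction (uZ f) (A x)
        = ∑ j, T.reducedCplx EZ E₀ j (T.toReduction (uZ f))
          (tderiv EZ E₀ T.toReduction (uZ f) (A (S.cplx j f x))) := by
    simp only [hA₀]
    exact h2
  rw [h1', h2']
  change _ ↔ (∀ x, T.Hor (uZ f).1 (tderiv EQ E (fun f => (uZ f).1) f (C.hlift f x)
    + T.kill (uZ f).1 (β x))) ∧ _
  simp only [← hA]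
  have hiff (hh : ∀ x, T.Hor (uZ f).1 (tderiv EZ E (Subtype.val : T.Level → M) (uZ f) (A x)))
      (x : EuclideanSpace ℝ (Fin 4)) :=
    TargetData.linearPart_iff_toReduction (E₀ := E₀) hsub hquot hreg (uZ f)
      (J := fun j => S.cplx j f) hh x
  constructor
  · intro hd
    have hh := TargetData.hor_of_tan_of_linearPart (T := T) (J := fun j => S.cplx j f)
      (fun x => TargetData.tan_tderiv_val hsub (uZ f) (A x)) hd
    exact ⟨hh, fun x => (hiff hh x).1 (hd x)⟩
  · rintro ⟨hh, hd⟩ x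
    exact (hiff hh x).2 (hd x)

end Descent

end Spinors

/-! ### One-forms with values in the Lie algebra -/

section Moduli

variable {X : Type*} [TopologicalSpace X] [ChartedSpace (EuclideanSpace ℝ (Fin 4)) X]
  [IsManifold (𝓡 4) ∞ X] {g : SmoothMetric (EuclideanSpace ℝ (Fin 4)) X}
  {o : ∀ x : X, Orientation ℝ (TangentSpace (𝓡 4) x) (Fin 4)}
  {EQ : Type*} [NormedAddCommGroup EQ] [NormedSpace ℝ EQ]
  {Q : Type*} [TopologicalSpace Q] [ChartedSpace EQ Q] [IsManifold 𝓘(ℝ, EQ) ∞ Q]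
  [MulAction Spin4ᵐᵒᵖ Q] {S : SpinStructure g o EQ Q} (C : LeviCivita S)
  {E : Type*} [NormedAddCommGroup E] [NormedSpace ℝ E]
  {M : Type*} [TopologicalSpace M] [ChartedSpace E M] [IsManifold 𝓘(ℝ, E) ∞ M]
  {L : Type*} [NormedAddCommGroup L] [NormedSpace ℝ L]
  {G : Type*} [Group G] [TopologicalSpace G] [ChartedSpace L G]
  [MulDistribMulAction Sp1 G] [MulAction G M] [MulAction Sp1 M]
  {T : TargetData E M L G}
  {EZ : Type*} [NormedAddCommGroup EZ] [NormedSpace ℝ EZ] [ChartedSpace EZ T.Level]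
  {E₀ : Type*} [NormedAddCommGroup E₀] [NormedSpace ℝ E₀] [ChartedSpace E₀ T.Reduction]

/-- A one-form on `X` is determined by its values on horizontal lifts. -/
lemma LieForm.apply_eq_hlift (b : LieForm S L G) (f : Q) (w : EQ) :
    b.toFun f w = b.toFun f (C.hlift f (S.dproj f w)) := by
  have key : ∀ B : EQ →L[ℝ] L, (∀ w, S.dproj f w = 0 → B w = 0) →
      B w = B (C.hlift f (S.dproj f w)) := by
    intro B hB
    rw [← sub_eq_zero, ← map_sub]
    apply hB
    rw [map_sub, S.dproj_hlift C, sub_self]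
  exact key (b.toFun f) (b.horizontal f)

lemma mdifferentiable_rightAct (S : SpinStructure g o EQ Q) (a : Spin4) :
    MDifferentiable 𝓘(ℝ, EQ) 𝓘(ℝ, EQ) (rightAct (Q := Q) a) :=
  (S.principal.smooth_act.comp (contMDiff_const.prodMk contMDiff_id) :
    ContMDiff 𝓘(ℝ, EQ) 𝓘(ℝ, EQ) ∞ (rightAct (Q := Q) a)).mdifferentiable (by simp)

/-! ### The connection form pulled back along a map to the level set -/

section PullbackForm

/-- The differential of a spinor, composed with the projection to the horizontal subspaces, is
equivariant. -/
lemma tderiv_hlift_rightAct (T : TargetData E M L G) (u : Spinor EQ Q E M) (a : Spin4) (f : Q)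
    (w : EQ) :
    tderiv EQ E u.toFun (rightAct a f) (C.hlift (rightAct a f)
        (S.dproj (rightAct a f) (tderiv EQ EQ (rightAct a) f w)))
      = tderiv E E (fun m : M => a.1⁻¹ • m) (u.toFun f)
          (tderiv EQ E u.toFun f (C.hlift f (S.dproj f w))) := by
  have hu : MDifferentiable 𝓘(ℝ, EQ) 𝓘(ℝ, E) u.toFun := u.smooth.mdifferentiable (by simp)
  have h1 : tderiv EQ EQ (rightAct a) f (C.hlift f (S.dproj f w))
      = C.hlift (rightAct a f) (S.dproj (rightAct a f) (tderiv EQ EQ (rightAct a) f w)) :=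
    C.lift_equivariant a f w
  have h2 : (fun f => u.toFun (rightAct a f)) = fun f => a.1⁻¹ • u.toFun f :=
    funext (u.equivariant a)
  rw [← h1, ← tderiv_comp (hu _) (mdifferentiable_rightAct S a f), h2,
    tderiv_comp ((T.contMDiff_Sp1_smul_left _).mdifferentiable (by simp) _) (hu f)]

variable [FiniteDimensional ℝ L] [LieGroup 𝓘(ℝ, L) ∞ G]

lemma contMDiff_tderiv_hlift (u : Spinor EQ Q E M) (h : ℍ[ℝ]) :
    ContMDiff 𝓘(ℝ, EQ) 𝓘(ℝ, E).tangent ∞ (fun f => (⟨u.toFun f, tderiv EQ E u.toFun f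
      (C.hlift f ((S.frame f).symm h))⟩ : TangentBundle 𝓘(ℝ, E) M)) :=
  (u.smooth.contMDiff_tangentMap (m := ∞) (by simp)).comp (C.lift_smooth h)

/-- The pull-back of the connection form along a spinor, precomposed with the projection to the
Levi-Civita horizontal subspaces, is a smooth one-form on `Q`. -/
lemma contMDiff_connForm_hlift (u : Spinor EQ Q E M)
    (hinj : ∀ f, Function.Injective (T.kill (u.toFun f))) :
    ContMDiff 𝓘(ℝ, EQ).tangent 𝓘(ℝ, L) ∞ (fun w : TangentBundle 𝓘(ℝ, EQ) Q =>
      T.connForm (u.toFun w.1) (tderiv EQ E u.toFun w.1 (C.hlift w.1 (S.dproj w.1 w.2)))) := by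
  let e := Module.finBasis ℝ ℍ[ℝ]
  let θ : TangentBundle 𝓘(ℝ, EQ) Q → ℍ[ℝ] := fun w => S.frame w.1 (S.dproj w.1 w.2)
  have hθ : ContMDiff 𝓘(ℝ, EQ).tangent 𝓘(ℝ, ℍ[ℝ]) ∞ θ := S.frame_smooth
  have hproj : ContMDiff 𝓘(ℝ, EQ).tangent 𝓘(ℝ, EQ) ∞
      (fun w : TangentBundle 𝓘(ℝ, EQ) Q => w.1) :=
    Bundle.contMDiff_proj (TangentSpace 𝓘(ℝ, EQ) (M := Q))
  -- in terms of the standard horizontal vector fields the form is a combination of the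
  -- coordinates of the soldering form `θ` with smooth coefficients
  have hsum (w : TangentBundle 𝓘(ℝ, EQ) Q) :
      T.connForm (u.toFun w.1) (tderiv EQ E u.toFun w.1 (C.hlift w.1 (S.dproj w.1 w.2)))
        = ∑ i, e.repr (θ w) i • T.connForm (u.toFun w.1)
            (tderiv EQ E u.toFun w.1 (C.hlift w.1 ((S.frame w.1).symm (e i)))) := by
    let F : ℍ[ℝ] →L[ℝ] EuclideanSpace ℝ (Fin 4) := (S.frame w.1).symm.toContinuousLinearMap
    have h1 : S.dproj w.1 w.2 = F (∑ i, e.repr (θ w) i • e i) := by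
      rw [e.sum_repr]
      exact ((S.frame w.1).symm_apply_apply _).symm
    rw [h1]
    simp only [map_sum, map_smul]
    rfl
  simp only [hsum]
  refine contMDiff_finsetSum fun i _ => ?_
  have : ContDiff ℝ ∞ (fun h : ℍ[ℝ] => e.repr h i) :=
    (LinearMap.toContinuousLinearMap (e.coord i)).contDiff
  exact (this.contMDiff.comp hθ).smul
    ((TargetData.contMDiff_connForm hinj (contMDiff_tderiv_hlift C u (e i))).comp hproj)

omit [LieGroup 𝓘(ℝ, L) ∞ G] in
/-- The form of `contMDiff_connForm_hlift` is equivariant: `Sp(1)` acts by isometries that permute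
the orbits, so both sides make the same vector horizontal. -/
lemma connForm_hlift_rightAct (u : Spinor EQ Q E M)
    (hinj : ∀ f, Function.Injective (T.kill (u.toFun f))) (a : Spin4) (f : Q) (w : EQ) :
    -T.connForm (u.toFun (rightAct a f)) (tderiv EQ E u.toFun (rightAct a f)
        (C.hlift (rightAct a f) (S.dproj (rightAct a f) (tderiv EQ EQ (rightAct a) f w))))
      = lieAct (G := G) a.1⁻¹
        (-T.connForm (u.toFun f) (tderiv EQ E u.toFun f (C.hlift f (S.dproj f w)))) := by
  rw [tderiv_hlift_rightAct C T]
  have hi := hinj (rightAct a f)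
  rw [u.equivariant] at hi ⊢
  refine TargetData.eq_of_hor_add_kill hi (v := tderiv E E (fun m : M => a.1⁻¹ • m) (u.toFun f)
        (tderiv EQ E u.toFun f (C.hlift f (S.dproj f w)))) ?_ ?_
  · rw [map_neg, ← sub_eq_add_neg]
    exact TargetData.hor_sub_kill_connForm hi _
  · rw [← TargetData.tderiv_Sp1_smul_kill, ← map_add]
    refine TargetData.Hor.Sp1_smul ?_ _
    rw [map_neg, ← sub_eq_add_neg]
    exact TargetData.hor_sub_kill_connForm (hinj f) _

/-- The one-form `b` for which the covariant derivative of `u` is horizontal: up to sign, the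
pull-back of the connection form of `μ⁻¹(0) → M₀`, made basic. -/
noncomputable def pullbackForm (u : Spinor EQ Q E M)
    (hinj : ∀ f, Function.Injective (T.kill (u.toFun f))) : LieForm S L G where
  toFun f := -(T.connForm (u.toFun f) ∘L tderiv EQ E u.toFun f ∘L C.hlift f ∘L S.dproj f)
  smooth := (contMDiff_connForm_hlift C u hinj).neg
  horizontal f w hw := by
    have hw' : S.dproj f w = 0 := hw
    change -(T.connForm (u.toFun f) (tderiv EQ E u.toFun f (C.hlift f (S.dproj f w)))) = 0
    rw [hw', map_zero, map_zero, map_zero, neg_zero]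
  equivariant a f w := connForm_hlift_rightAct C u hinj a f w

/-- The covariant derivative of `u` with respect to `pullbackForm` is orthogonal to the orbits. -/
lemma hor_pullbackForm (u : Spinor EQ Q E M)
    (hinj : ∀ f, Function.Injective (T.kill (u.toFun f))) (f : Q)
    (x : EuclideanSpace ℝ (Fin 4)) :
    T.Hor (u.toFun f) (tderiv EQ E u.toFun f (C.hlift f x)
      + T.kill (u.toFun f) ((pullbackForm (T := T) C u hinj).toFun f (C.hlift f x))) := by
  have h : (pullbackForm (T := T) C u hinj).toFun f (C.hlift f x)
      = -(T.connForm (u.toFun f) (tderiv EQ E u.toFun f (C.hlift f x))) := by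
    change -(T.connForm (u.toFun f) (tderiv EQ E u.toFun f
      (C.hlift f (S.dproj f (C.hlift f x))))) = _
    rw [S.dproj_hlift C]
  have h' := TargetData.hor_sub_kill_connForm (hinj f) (tderiv EQ E u.toFun f (C.hlift f x))
  rw [sub_eq_add_neg, ← map_neg, ← h] at h'
  exact h'

end PullbackForm

/-! ### Gauge transformations -/

section Gauge

variable [LieGroup 𝓘(ℝ, L) ∞ G]

omit [IsManifold 𝓘(ℝ, EQ) ∞ Q] [MulAction Spin4ᵐᵒᵖ Q] in
/-- The covariant derivative of `γ u` with respect to `Ad_γ b - (∇γ) γ⁻¹` is the image of that of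
`u` under `γ`. -/
lemma tderiv_gauge {γ : Q → G} {u u' : Q → M} (hγ : ContMDiff 𝓘(ℝ, EQ) 𝓘(ℝ, L) ∞ γ)
    (hu : ContMDiff 𝓘(ℝ, EQ) 𝓘(ℝ, E) ∞ u) (hu' : ∀ f, u' f = γ f • u f) (f : Q) (x : EQ) (ξ : L) :
    tderiv EQ E u' f x + T.kill (u' f) (adjoint (γ f) ξ
        - tderiv EQ L (fun f' => γ f' * (γ f)⁻¹) f x)
      = tderiv E E (fun m : M => γ f • m) (u f) (tderiv EQ E u f x + T.kill (u f) ξ) := by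
  have hδ : MDifferentiable 𝓘(ℝ, EQ) 𝓘(ℝ, L) (fun f' => γ f' * (γ f)⁻¹) :=
    (hγ.mul contMDiff_const).mdifferentiable (by simp)
  have hm : MDifferentiable 𝓘(ℝ, E) 𝓘(ℝ, E) (fun m : M => γ f • m) :=
    (T.contMDiff_smul_left _).mdifferentiable (by simp)
  have hu₁ : MDifferentiable 𝓘(ℝ, EQ) 𝓘(ℝ, E) u := hu.mdifferentiable (by simp)
  have h := tderiv_comp₂ (E := EQ) (E' := L) (E'' := E) (E₃ := E)
    (F := fun (k : G) (m : M) => k • m) (a := fun f' => γ f' * (γ f)⁻¹)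
    (b := fun f' => γ f • u f') (x := f)
    (T.smooth_G.mdifferentiable (by simp) _) (hδ f) ((hm _).comp f (hu₁ f)) x
  have he : (fun f' => (γ f' * (γ f)⁻¹) • γ f • u f') = u' := by
    funext f'
    rw [hu', smul_smul, inv_mul_cancel_right]
  have h1 : (fun m : M => (1 : G) • m) = fun m => m := by funext m; exact one_smul G m
  rw [he, mul_inv_cancel, h1, tderiv_id, tderiv_comp (hm _) (hu₁ f), ← hu'] at h
  rw [h, map_sub, map_add, TargetData.tderiv_smul_kill, ← hu', TargetData.kill_eq]
  simp only [ContinuousLinearMap.id_apply]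
  abel

/-- Two equivariant maps to the level set with the same projection to the reduction differ by a
gauge transformation. Freeness makes it unique pointwise, hence equivariant, and local
trivializations of the principal bundle make it smooth. -/
lemma exists_gaugeTransformation (hfree : T.FreeOnLevel)
    (hquot : IsPrincipalBundle 𝓘(ℝ, E₀) 𝓘(ℝ, EZ) 𝓘(ℝ, L)
      (fun (h : G) (z : T.Level) => h • z) T.toReduction)
    {u u' : Q → T.Level} (hu : ContMDiff 𝓘(ℝ, EQ) 𝓘(ℝ, EZ) ∞ u)
    (hu' : ContMDiff 𝓘(ℝ, EQ) 𝓘(ℝ, EZ) ∞ u')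
    (hue : ∀ (a : Spin4) f, u (rightAct a f) = a.1⁻¹ • u f)
    (hue' : ∀ (a : Spin4) f, u' (rightAct a f) = a.1⁻¹ • u' f)
    (he : ∀ f, T.toReduction (u' f) = T.toReduction (u f)) :
    ∃ γ : GaugeTransformation EQ Q L G, ∀ f, u' f = γ.toFun f • u f := by
  choose γ hγ using fun f => TargetData.toReduction_eq_iff.1 (he f)
  have huniq {k k' : G} {z : T.Level} (h : k • z = k' • z) : k = k' := by
    have h1 : (k'⁻¹ * k) • z.1 = z.1 := by
      have h2 : (k'⁻¹ * k) • z = z := by rw [mul_smul, h, inv_smul_smul]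
      exact congrArg Subtype.val h2
    exact (inv_mul_eq_one.1 (hfree z.1 _ z.2 h1)).symm
  have hπ : ContMDiff 𝓘(ℝ, EZ) 𝓘(ℝ, E₀) ∞ T.toReduction := hquot.smooth_proj
  refine ⟨⟨γ, fun f => ?_, fun a f => ?_⟩, fun f => (hγ f).symm⟩
  · obtain ⟨U, hU, hfU, s, τ, hs, hτ, hsτ, hτs⟩ := hquot.locally_trivial (T.toReduction (u f))
    have hVo : IsOpen (T.toReduction ⁻¹' U) := hU.preimage hπ.continuous
    have hfU' : T.toReduction (u' f) ∈ U := (he f).symm ▸ hfU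
    have h1 : ContMDiffAt 𝓘(ℝ, EQ) 𝓘(ℝ, L) ∞ (fun f' => τ (u f')) f :=
      ((hτ _ hfU).contMDiffAt (hVo.mem_nhds hfU)).comp f (hu f)
    have h2 : ContMDiffAt 𝓘(ℝ, EQ) 𝓘(ℝ, L) ∞ (fun f' => τ (u' f')) f :=
      ((hτ _ hfU').contMDiffAt (hVo.mem_nhds hfU')).comp f (hu' f)
    refine (h2.mul h1.inv).congr_of_eventuallyEq ?_
    filter_upwards [(hVo.preimage hu.continuous).mem_nhds hfU] with f' hf'
    refine huniq (z := u f') ?_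
    have h3 : τ (u f') • s (T.toReduction (u f')) = u f' := hτs _ hf'
    have h4 : τ (u' f') • s (T.toReduction (u' f')) = u' f' :=
      hτs _ (by rw [Set.mem_preimage, he]; exact hf')
    change γ f' • u f' = (τ (u' f') * (τ (u f'))⁻¹) • u f'
    rw [hγ, mul_smul, inv_smul_eq_iff.2 h3.symm, ← he]
    exact h4.symm
  · refine huniq (z := u (rightAct a f)) ?_
    rw [hγ, hue, hue', ← hγ f]
    exact Subtype.ext (T.semidirect _ _ _)

end Gauge

end Moduli

/-! ### The moduli space and the harmonic spinors -/

section ModuliMap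

variable {X : Type*} [TopologicalSpace X] [ChartedSpace (EuclideanSpace ℝ (Fin 4)) X]
  [IsManifold (𝓡 4) ∞ X] {g : SmoothMetric (EuclideanSpace ℝ (Fin 4)) X}
  {o : ∀ x : X, Orientation ℝ (TangentSpace (𝓡 4) x) (Fin 4)}
  {EQ : Type*} [NormedAddCommGroup EQ] [NormedSpace ℝ EQ]
  {Q : Type*} [TopologicalSpace Q] [ChartedSpace EQ Q] [IsManifold 𝓘(ℝ, EQ) ∞ Q]
  [MulAction Spin4ᵐᵒᵖ Q] {S : SpinStructure g o EQ Q} {C : LeviCivita S}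
  {E : Type*} [NormedAddCommGroup E] [NormedSpace ℝ E]
  {M : Type*} [TopologicalSpace M] [ChartedSpace E M] [IsManifold 𝓘(ℝ, E) ∞ M]
  {L : Type*} [NormedAddCommGroup L] [NormedSpace ℝ L]
  {G : Type*} [Group G] [TopologicalSpace G] [ChartedSpace L G]
  [MulDistribMulAction Sp1 G] [MulAction G M] [MulAction Sp1 M]
  {T : TargetData E M L G}
  {EZ : Type*} [NormedAddCommGroup EZ] [NormedSpace ℝ EZ] [ChartedSpace EZ T.Level]
  {E₀ : Type*} [NormedAddCommGroup E₀] [NormedSpace ℝ E₀] [ChartedSpace E₀ T.Reduction]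

/-- The spinor of a solution of the limiting system, as a map to the level set. -/
def LimitingSolution.toLevel (s : LimitingSolution C T) (f : Q) : T.Level :=
  ⟨s.u.toFun f, s.moment_eq f⟩

lemma LimitingSolution.toLevel_rightAct (s : LimitingSolution C T) (a : Spin4) (f : Q) :
    s.toLevel (rightAct a f) = a.1⁻¹ • s.toLevel f :=
  Subtype.ext (s.u.equivariant a f)

variable
  (hquot : IsPrincipalBundle 𝓘(ℝ, E₀) 𝓘(ℝ, EZ) 𝓘(ℝ, L) (fun (h : G) (z : T.Level) => h • z)
    T.toReduction)

/-- The projection to the reduction of an equivariant map to the level set. -/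
def reducedSpinor
    {uZ : Q → T.Level} (hu : ContMDiff 𝓘(ℝ, EQ) 𝓘(ℝ, EZ) ∞ uZ)
    (hue : ∀ (a : Spin4) f, uZ (rightAct a f) = a.1⁻¹ • uZ f) : Spinor EQ Q E₀ T.Reduction where
  toFun f := T.toReduction (uZ f)
  smooth := hquot.smooth_proj.comp hu
  equivariant a f := congrArg T.toReduction (hue a f)

/-- The trivialization of the pulled-back bundle given by a lift to the level set. -/
lemma hasTrivialPullback_reducedSpinor
    {uZ : Q → T.Level} (hu : ContMDiff 𝓘(ℝ, EQ) 𝓘(ℝ, EZ) ∞ uZ)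
    (hue : ∀ (a : Spin4) f, uZ (rightAct a f) = a.1⁻¹ • uZ f) :
    HasTrivialPullback T EZ (reducedSpinor hquot hu hue) :=
  ⟨fun h f => h • uZ f,
    hquot.smooth_act.comp (contMDiff_fst.prodMk (hu.comp contMDiff_snd)),
    fun h f => TargetData.toReduction_eq_iff.2 ⟨h, rfl⟩,
    fun k h f => mul_smul k h (uZ f),
    fun a h f => by
      change (a.1⁻¹ • h) • uZ (rightAct a f) = a.1⁻¹ • h • uZ f
      rw [hue]
      exact Subtype.ext (T.semidirect _ _ _).symm⟩

variable
  (hsub : Manifold.IsSmoothEmbedding 𝓘(ℝ, EZ) 𝓘(ℝ, E) ∞ (Subtype.val : T.Level → M))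
  [LieGroup 𝓘(ℝ, L) ∞ G] [IsManifold 𝓘(ℝ, EZ) ∞ T.Level] [FiniteDimensional ℝ E]
  [FiniteDimensional ℝ L] [FiniteDimensional ℝ E₀] (hreg : T.ZeroIsRegular)

include hsub in
omit [LieGroup 𝓘(ℝ, L) ∞ G] [FiniteDimensional ℝ E] [FiniteDimensional ℝ L]
  [FiniteDimensional ℝ E₀] in
lemma LimitingSolution.contMDiff_toLevel (s : LimitingSolution C T) :
    ContMDiff 𝓘(ℝ, EQ) 𝓘(ℝ, EZ) ∞ s.toLevel :=
  TargetData.contMDiff_level hsub s.u.smooth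

/-- The pure harmonic spinor defined by a solution of the limiting system. -/
def LimitingSolution.toHarmonicSpinor (s : LimitingSolution C T) : HarmonicSpinors C T EZ E₀ :=
  ⟨reducedSpinor hquot (s.contMDiff_toLevel hsub) s.toLevel_rightAct,
    hasTrivialPullback_reducedSpinor hquot (s.contMDiff_toLevel hsub) s.toLevel_rightAct,
    fun f => ((dirac_eq_zero_iff hsub hquot hreg C s.u s.b (uZ := s.toLevel) (fun _ => rfl)
      _ (fun _ => rfl) f).1 (s.dirac_eq f)).2⟩

lemma LimitingSolution.toHarmonicSpinor_eq_iff (s s' : LimitingSolution C T) :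
    s.toHarmonicSpinor hquot hsub hreg = s'.toHarmonicSpinor hquot hsub hreg
      ↔ ∀ f, T.toReduction (s.toLevel f) = T.toReduction (s'.toLevel f) := by
  constructor
  · intro h f
    exact congrFun (congrArg (fun v => v.1.toFun) h) f
  · intro h
    have h' : (fun f => T.toReduction (s.toLevel f)) = fun f => T.toReduction (s'.toLevel f) :=
      funext h
    refine Subtype.ext ?_
    simp only [toHarmonicSpinor, reducedSpinor, h']

include hquot hsub hreg in
/-- Gauge equivalence of solutions is equality of the projections to the reduction: the gauge
transformation relating the spinors also relates the one-forms, because the one-form of a solution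
is determined by the horizontality of the covariant derivative. -/
lemma gaugeRelated_iff (hfree : T.FreeOnLevel) (s s' : LimitingSolution C T) :
    GaugeRelated s s' ↔ ∀ f, T.toReduction (s'.toLevel f) = T.toReduction (s.toLevel f) := by
  constructor
  · rintro ⟨γ, hγ, -⟩ f
    exact TargetData.toReduction_eq_iff.2 ⟨γ.toFun f, Subtype.ext (hγ f).symm⟩
  · intro h
    obtain ⟨γ, hγ⟩ := exists_gaugeTransformation hfree hquot (s.contMDiff_toLevel hsub)
      (s'.contMDiff_toLevel hsub) s.toLevel_rightAct s'.toLevel_rightAct h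
    have hγ' (f : Q) : s'.u.toFun f = γ.toFun f • s.u.toFun f := congrArg Subtype.val (hγ f)
    have hh (s : LimitingSolution C T) (f : Q) (x : EuclideanSpace ℝ (Fin 4)) :=
      ((dirac_eq_zero_iff hsub hquot hreg C s.u s.b (uZ := s.toLevel) (fun _ => rfl)
        (reducedSpinor hquot (s.contMDiff_toLevel hsub) s.toLevel_rightAct)
        (fun _ => rfl) f).1 (s.dirac_eq f)).1 x
    refine ⟨γ, hγ', fun f w => ?_⟩
    refine (s'.b.apply_eq_hlift C f w).trans (Eq.trans ?_ (congrArg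
      (fun ξ => adjoint (γ.toFun f) ξ - gaugeForm C γ f w) (s.b.apply_eq_hlift C f w).symm))
    refine TargetData.eq_of_hor_add_kill (T.kill_injective hreg (s'.moment_eq f)) (hh s' f _) ?_
    have ht := tderiv_gauge (T := T) γ.smooth s.u.smooth hγ' f (C.hlift f (S.dproj f w))
      (s.b.toFun f (C.hlift f (S.dproj f w)))
    have hH := (hh s f (S.dproj f w)).smul (γ.toFun f)
    rw [← hγ' f, ← ht] at hH
    exact hH

include hquot hreg in
/-- A pure harmonic spinor whose pulled-back bundle is trivial lifts to a solution, the one-form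
being minus the pull-back of the connection form. -/
lemma exists_toHarmonicSpinor_eq (v : HarmonicSpinors C T EZ E₀) :
    ∃ s : LimitingSolution C T, s.toHarmonicSpinor hquot hsub hreg = v := by
  obtain ⟨⟨v, hvs, hve⟩, ⟨ψ, hψ, hψv, -, hψe⟩, hv⟩ := v
  have hu : ContMDiff 𝓘(ℝ, EQ) 𝓘(ℝ, EZ) ∞ (ψ 1) :=
    hψ.comp (contMDiff_const.prodMk contMDiff_id)
  have hue (a : Spin4) (f : Q) : ψ 1 (rightAct a f) = a.1⁻¹ • ψ 1 f := by
    simpa only [smul_one] using hψe a 1 f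
  let u : Spinor EQ Q E M := ⟨fun f => (ψ 1 f).1, hsub.contMDiff.comp hu,
    fun a f => congrArg Subtype.val (hue a f)⟩
  have hinj (f : Q) : Function.Injective (T.kill (u.toFun f)) :=
    T.kill_injective hreg (ψ 1 f).2
  refine ⟨⟨u, pullbackForm C u hinj, fun f => ?_, fun f => (ψ 1 f).2⟩, ?_⟩
  · exact (dirac_eq_zero_iff hsub hquot hreg C u _ (uZ := ψ 1) (fun _ => rfl) _
      (fun f => (hψv 1 f).symm) f).2 ⟨hor_pullbackForm C u hinj f, hv f⟩
  · obtain rfl : (fun f => T.toReduction (ψ 1 f)) = v := funext (hψv 1)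
    rfl

end ModuliMap

theorem mainTheorem2
    -- the source: an oriented Riemannian spin four-manifold with its Levi-Civita connection
    {X : Type*} [TopologicalSpace X] [T2Space X] [SecondCountableTopology X]
    [ChartedSpace (EuclideanSpace ℝ (Fin 4)) X] [IsManifold (𝓡 4) ∞ X]
    {g : SmoothMetric (EuclideanSpace ℝ (Fin 4)) X}
    {o : ∀ x : X, Orientation ℝ (TangentSpace (𝓡 4) x) (Fin 4)}
    {EQ : Type*} [NormedAddCommGroup EQ] [NormedSpace ℝ EQ] [FiniteDimensional ℝ EQ]
    {Q : Type*} [TopologicalSpace Q] [ChartedSpace EQ Q] [IsManifold 𝓘(ℝ, EQ) ∞ Q]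
    [MulAction Spin4ᵐᵒᵖ Q]
    (S : SpinStructure g o EQ Q) (C : LeviCivita S)
    -- the target: a hyperKähler manifold with an action of `G ⋊ Sp(1)`
    {L : Type*} [NormedAddCommGroup L] [NormedSpace ℝ L] [FiniteDimensional ℝ L]
    {G : Type*} [Group G] [TopologicalSpace G] [ChartedSpace L G] [LieGroup 𝓘(ℝ, L) ∞ G]
    [MulDistribMulAction Sp1 G]
    {E : Type*} [NormedAddCommGroup E] [NormedSpace ℝ E] [FiniteDimensional ℝ E]
    {M : Type*} [TopologicalSpace M] [T2Space M] [SecondCountableTopology M]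
    [ChartedSpace E M] [IsManifold 𝓘(ℝ, E) ∞ M] [MulAction G M] [MulAction Sp1 M]
    (T : TargetData E M L G) (hreg : T.ZeroIsRegular) (hfree : T.FreeOnLevel)
    -- the smooth structures of the submanifold `μ⁻¹(0)` and of the quotient `M₀ = μ⁻¹(0)/G`
    {EZ : Type*} [NormedAddCommGroup EZ] [NormedSpace ℝ EZ] [FiniteDimensional ℝ EZ]
    [ChartedSpace EZ T.Level] [IsManifold 𝓘(ℝ, EZ) ∞ T.Level]
    (hsub : Manifold.IsSmoothEmbedding 𝓘(ℝ, EZ) 𝓘(ℝ, E) ∞ (Subtype.val : T.Level → M))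
    {E₀ : Type*} [NormedAddCommGroup E₀] [NormedSpace ℝ E₀] [FiniteDimensional ℝ E₀]
    [ChartedSpace E₀ T.Reduction] [IsManifold 𝓘(ℝ, E₀) ∞ T.Reduction]
    (hquot : IsPrincipalBundle 𝓘(ℝ, E₀) 𝓘(ℝ, EZ) 𝓘(ℝ, L) (fun (h : G) (z : T.Level) => h • z)
      T.toReduction) :
    -- sending `(u, b)` to the projection of `u` is a well-defined bijection
    ∃ Φ : LimitingModuli C T ≃ HarmonicSpinors C T EZ E₀,
      ∀ s : LimitingSolution C T, ∀ f : Q,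
        (Φ (Quot.mk _ s)).1.toFun f = T.toReduction ⟨s.u.toFun f, s.moment_eq f⟩ := by
  have hrel (s s' : LimitingSolution C T) : GaugeRelated s s' ↔
      s.toHarmonicSpinor hquot hsub hreg = s'.toHarmonicSpinor hquot hsub hreg := by
    rw [gaugeRelated_iff hquot hsub hreg hfree, LimitingSolution.toHarmonicSpinor_eq_iff]
    exact forall_congr' fun f => eq_comm
  refine ⟨Equiv.ofBijective (Quot.lift (fun s => s.toHarmonicSpinor hquot hsub hreg)
    fun s s' h => (hrel s s').1 h) ⟨?_, fun v => ?_⟩, fun s f => rfl⟩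
  · rintro ⟨s⟩ ⟨s'⟩ h
    exact Quot.sound ((hrel s s').2 h)
  · obtain ⟨s, hs⟩ := exists_toHarmonicSpinor_eq hquot hsub hreg v
    exact ⟨Quot.mk _ s, hs⟩
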